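/- All graphs are finite and simple. For a graph $G$ with Laplacian matrix $L(G)=D(G)-A(G)$, let $m_G(\mu)$ be the multiplicity of $\mu$ as an eigenvalue of $L(G)$ and, for an interval $I$, let $m_G I$ be the number of eigenvalues of $L(G)$ in $I$, counted with multiplicity. $K_n$ is the complete graph on $n$ vertices, $\cup$ and $\vee$ denote the disjoint union and the join of graphs, $sH$ is the disjoint union of $s$ copies of $H$, $\overline{H}$ is the complement of $H$, and $G-E_1$ is $G$ with the edges in $E_1$ removed. For $n\ge 5$, $H(n)$ is the graph obtained from $K_{n-1}$ by removing an edge $e$ and adding a new vertex adjacent to exactly one vertex, an end of $e$. For $1\le a\le\lfloor\frac{n-4}{2}\rfloor$, $H(n,a)$ is the graph obtained from the disjoint union of a path $v_1v_2v_3v_4$ and $K_{n-4}$ by joining $v_2$ and $v_3$ to all vertices of $K_{n-4}$, $v_1$ to $a$ vertices of $K_{n-4}$, and $v_4$ to the remaining $n-4-a$ vertices of $K_{n-4}$. **Theorem.** Let $G$ be a connected graph of order $n\ge 5$ with girth $3$. (i) $m_G(n)=n-1$ if and only if $G\cong K_n$, and $m_G(n)=n-2$ if and only if $G\cong K_n-e$,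 where $e$ is an edge of $K_n$. If $G\not\cong K_n, K_n-e$, then $m_G(n)\le n-3$, with equality if and only if $G$ is isomorphic to $K_{n-3}\vee 3K_1$, $K_{n-3}\vee(K_1\cup K_2)$ or $K_{n-4}\vee\overline{2K_2}$ (where $\overline{2K_2}$ is the $4$-cycle). (ii) $m_G[n-1,n]=n-1$ if and only if $G\cong K_n$, and $m_G[n-1,n]=n-2$ if and only if $G\cong K_n-\{vv_i:i=1,\dots,s\}$ for some $s\in\{1,\dots,n-2\}$, where $v,v_1,\dots,v_s$ are distinct vertices of $K_n$. If $G$ is isomorphic neither to $K_n$ nor to any of these graphs $K_n-\{vv_i:i=1,\dots,s\}$, then $m_G[n-1,n]\le n-3$, with equality if and only if $G\cong H(n)$, or $G\cong H(n,a)$ for some $a\in\{1,\dots,\lfloor\frac{n-4}{2}\rfloor\}$, or $G$ is isomorphic to one of the following graphs: (a) $K_n-\{vv_i:i=1,\dots,s\}-v_1v_2$ for some $s\in\{2,\dots,n-2\}$, where $v,v_1,\dots,v_s$ are distinct vertices of $K_n$; (b) $K_n-\{vv_i:i=1,\dots,s\}-\{uu_j:j=1,\dots,t\}$ for some $s\in\{1,\dots,n-3\}$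 and $t\in\{1,\dots,\min\{s,n-2-s\}\}$, where $v,v_1,\dots,v_s,u,u_1,\dots,u_t$ are distinct vertices of $K_n$; (c) $K_n-\{vv_i:i=1,\dots,s\}-\{v_1u_j:j=1,\dots,t\}$ for some $s\in\{2,\dots,n-2\}$ and $t\in\{1,\dots,\min\{s-1,n-1-s\}\}$, where $v,v_1,\dots,v_s,u_1,\dots,u_t$ are distinct vertices of $K_n$. -/

import Mathlib

namespace GirthThree

/-- `m_G I`: the number of Laplacian eigenvalues of `G` in `I`, counted with multiplicity.
`m_G {μ}` is the multiplicity of `μ` as a Laplacian eigenvalue. -/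
noncomputable def lapCount {V : Type*} [Fintype V] [DecidableEq V] (G : SimpleGraph V)
    [DecidableRel G.Adj] (I : Set ℝ) : ℕ :=
  Nat.card {i : V // (G.isHermitian_lapMatrix ℝ).eigenvalues i ∈ I}

/-- `G` and `H` are isomorphic graphs. -/
def Isom {V W : Type*} (G : SimpleGraph V) (H : SimpleGraph W) : Prop := Nonempty (G ≃g H)

/-- The complete graph `K_n`. -/
abbrev K (n : ℕ) : SimpleGraph (Fin n) := ⊤

/-- The join of vertex-disjoint graphs. -/
def join {V W : Type*} (G : SimpleGraph V) (H : SimpleGraph W) : SimpleGraph (V ⊕ W) :=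
  (G ⊕g H) ⊔ completeBipartiteGraph V W

/-- The set of edges `{v w : w ∈ S}`. -/
def starEdges {V : Type*} (v : V) (S : Finset V) : Set (Sym2 V) := {e | ∃ w ∈ S, e = s(v, w)}

/-- `G ≅ K_n - e` for an edge `e` of `K_n`. -/
def IsCompleteMinusEdge (n : ℕ) {V : Type*} (G : SimpleGraph V) : Prop :=
  ∃ e ∈ (K n).edgeSet, Isom G ((K n).deleteEdges {e})

/-- `G ≅ K_n - {v v_i : i = 1, …, s}` for some `1 ≤ s ≤ n - 2`; here `S = {v_1, …, v_s}`. -/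
def IsCompleteMinusStar (n : ℕ) {V : Type*} (G : SimpleGraph V) : Prop :=
  ∃ (v : Fin n) (S : Finset (Fin n)), v ∉ S ∧ 1 ≤ S.card ∧ S.card ≤ n - 2 ∧
    Isom G ((K n).deleteEdges (starEdges v S))

/-- The graph obtained from `K_{n-1}` by removing the edge `x y` and joining a new vertex
(`none`) to `x`. -/
def graphH (n : ℕ) (x y : Fin (n - 1)) : SimpleGraph (Option (Fin (n - 1))) :=
  ((K (n - 1)).deleteEdges {s(x, y)}).map Function.Embedding.some ⊔ SimpleGraph.edge none (some x)

/-- `G ≅ H(n)`. -/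
def IsH (n : ℕ) {V : Type*} (G : SimpleGraph V) : Prop :=
  ∃ x y : Fin (n - 1), x ≠ y ∧ Isom G (graphH n x y)

/-- `H(n, a)`: the disjoint union of the path `P_4` (vertices `0, 1, 2, 3` in this order) and
`K_{n-4}`, where in addition `1` and `2` are joined to all of `K_{n-4}`, `0` to the first `a`
vertices of `K_{n-4}`, and `3` to the others. -/
def graphHa (n a : ℕ) : SimpleGraph (Fin 4 ⊕ Fin (n - 4)) :=
  (SimpleGraph.pathGraph 4 ⊕g K (n - 4)) ⊔ SimpleGraph.fromEdgeSet
    {e | ∃ (i : Fin 4) (j : Fin (n - 4)), e = s(Sum.inl i, Sum.inr j) ∧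
      (i = 1 ∨ i = 2 ∨ (i = 0 ∧ (j : ℕ) < a) ∨ (i = 3 ∧ a ≤ (j : ℕ)))}

/-- `G ≅ H(n, a)` for some `1 ≤ a ≤ ⌊(n - 4) / 2⌋`. -/
def IsHa (n : ℕ) {V : Type*} (G : SimpleGraph V) : Prop :=
  ∃ a : ℕ, 1 ≤ a ∧ a ≤ (n - 4) / 2 ∧ Isom G (graphHa n a)

/-- Family (a): `K_n - {v v_i : i = 1, …, s} - v_1 v_2` with `2 ≤ s ≤ n - 2`. -/
def FamilyA (n : ℕ) {V : Type*} (G : SimpleGraph V) : Prop :=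
  ∃ (v v₁ v₂ : Fin n) (S : Finset (Fin n)), v ∉ S ∧ v₁ ∈ S ∧ v₂ ∈ S ∧ v₁ ≠ v₂ ∧
    2 ≤ S.card ∧ S.card ≤ n - 2 ∧
    Isom G (((K n).deleteEdges (starEdges v S)).deleteEdges {s(v₁, v₂)})

/-- Family (b): `K_n - {v v_i : i = 1, …, s} - {u u_j : j = 1, …, t}` with `1 ≤ s ≤ n - 3`,
`1 ≤ t ≤ min {s, n - 2 - s}` and `v, v_1, …, v_s, u, u_1, …, u_t` distinct. -/
def FamilyB (n : ℕ) {V : Type*} (G : SimpleGraph V) : Prop :=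
  ∃ (v u : Fin n) (S T : Finset (Fin n)), v ≠ u ∧ v ∉ S ∧ v ∉ T ∧ u ∉ S ∧ u ∉ T ∧
    Disjoint S T ∧ 1 ≤ S.card ∧ S.card ≤ n - 3 ∧
    1 ≤ T.card ∧ T.card ≤ min S.card (n - 2 - S.card) ∧
    Isom G (((K n).deleteEdges (starEdges v S)).deleteEdges (starEdges u T))

/-- Family (c): `K_n - {v v_i : i = 1, …, s} - {v_1 u_j : j = 1, …, t}` with `2 ≤ s ≤ n - 2`,
`1 ≤ t ≤ min {s - 1, n - 1 - s}` and `v, v_1, …, v_s, u_1, …, u_t` distinct. -/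
def FamilyC (n : ℕ) {V : Type*} (G : SimpleGraph V) : Prop :=
  ∃ (v v₁ : Fin n) (S T : Finset (Fin n)), v ∉ S ∧ v ∉ T ∧ v₁ ∈ S ∧ Disjoint S T ∧
    2 ≤ S.card ∧ S.card ≤ n - 2 ∧
    1 ≤ T.card ∧ T.card ≤ min (S.card - 1) (n - 1 - S.card) ∧
    Isom G (((K n).deleteEdges (starEdges v S)).deleteEdges (starEdges v₁ T))

end GirthThree

/-! Everything is read off the complement. Since `L(G) + L(Gᶜ) = nI - J`, the quadratic form of
`L(G)` is `n|x|²` minus `(∑ xᵢ)²` minus the Laplacian form of `Gᶜ` (`lapMatrix_form`). Hence the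
number of eigenvalues of `G` in `[n-c, n]` is `n - 1` minus the number of Laplacian eigenvalues of
`Gᶜ` that exceed `c`. Both halves of the theorem ask which complements have at most zero, one or two
eigenvalues above `c`, with `c = 0` in (i) and `c = 1` in (ii).

The Laplacian form only grows when edges are added, so a small subgraph of `Gᶜ` with `k` eigenvalues
above `c` already forces `k` such eigenvalues (`lapCount_add_le`). Conversely, `k` linear conditions
that bring the form down to `c|x|²` allow at most `k` of them (`le_lapCount_add`). For `c = 0` the
conditions equate coordinates along the edges of `Gᶜ`. For `c = 1` they make the coordinates at star
centres vanish, after which every leaf `j` costs only `x j ²` (`complForm_le_sum_sq`).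

What remains is combinatorial. For `c = 1`, excluding `2K₂` and `K₃` leaves a star; excluding `3K₂`,
`P₅`, `C₄` and `K₃ ∪ K₂` leaves a star plus one edge, or two stars without a common leaf
(`classification`). For `c = 0`, excluding all three-edge forests leaves a subgraph of a triangle or
of a pair of disjoint edges (`classification_of_no_forest`). These shapes are then matched with the
listed graphs; connectedness bounds the sizes of the stars. Under the standing assumptions `H(n)`
and `H(n,a)` are covered by families (b) and (c). -/

namespace GirthThree

/-! ### Counting eigenvalues below a threshold by dimension (Courant–Fischer). -/

section Spectral

variable {V : Type*} [Fintype V] [DecidableEq V]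

/-- Coordinates in an orthonormal eigenbasis of a real symmetric matrix. -/
theorem exists_eigenCoordinates {A : Matrix V V ℝ} (hA : A.IsHermitian) :
    ∃ T : (V → ℝ) ≃ₗ[ℝ] (V → ℝ), ∀ x, ∑ i, x i ^ 2 = ∑ i, T x i ^ 2 ∧
      x ⬝ᵥ A.mulVec x = ∑ i, hA.eigenvalues i * T x i ^ 2 := by
  set b := hA.eigenvectorBasis with hb
  have key : ∀ (i : V) (x : V → ℝ), inner ℝ (b i) (WithLp.toLp 2 (A.mulVec x)) =
      hA.eigenvalues i * inner ℝ (b i) (WithLp.toLp 2 x) := by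
    intro i x
    have hT : A.transpose = A := by
      have := hA.eq
      rwa [Matrix.conjTranspose_eq_transpose_of_trivial] at this
    simp only [EuclideanSpace.inner_eq_star_dotProduct, star_trivial]
    rw [dotProduct_comm, Matrix.dotProduct_mulVec, ← Matrix.mulVec_transpose, hT, hb,
      hA.mulVec_eigenvectorBasis, smul_dotProduct, smul_eq_mul, dotProduct_comm]
  refine ⟨(WithLp.linearEquiv 2 ℝ (V → ℝ)).symm ≪≫ₗ b.repr.toLinearEquiv ≪≫ₗ
    WithLp.linearEquiv 2 ℝ (V → ℝ), fun x => ?_⟩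
  have hT : ∀ i, ((WithLp.linearEquiv 2 ℝ (V → ℝ)).symm ≪≫ₗ b.repr.toLinearEquiv ≪≫ₗ
      WithLp.linearEquiv 2 ℝ (V → ℝ)) x i = inner ℝ (b i) (WithLp.toLp 2 x) := by
    intro i
    simp [b.repr_apply_apply]
  simp only [hT]
  constructor
  · have h := b.sum_inner_mul_inner (WithLp.toLp 2 x) (WithLp.toLp 2 x)
    rw [EuclideanSpace.inner_eq_star_dotProduct] at h
    simp only [star_trivial, dotProduct] at h
    simp only [sq]
    rw [← h]
    exact Finset.sum_congr rfl fun i _ => by rw [real_inner_comm]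
  · have h := b.sum_inner_mul_inner (WithLp.toLp 2 x) (WithLp.toLp 2 (A.mulVec x))
    rw [EuclideanSpace.inner_eq_star_dotProduct] at h
    simp only [star_trivial] at h
    rw [dotProduct_comm, ← h]
    refine Finset.sum_congr rfl fun i _ => ?_
    rw [key, real_inner_comm]
    ring

/-- If the quadratic form of `A` is below `c` on a `k`-dimensional space, then `A` has at least
`k` eigenvalues below `c`. -/
theorem finrank_le_card_eigenvalues_lt {A : Matrix V V ℝ} (hA : A.IsHermitian) (c : ℝ)
    {E : Type*} [AddCommGroup E] [Module ℝ E] [FiniteDimensional ℝ E] (g : E →ₗ[ℝ] (V → ℝ))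
    (hg : ∀ y, y ≠ 0 → g y ⬝ᵥ A.mulVec (g y) < c * ∑ i, g y i ^ 2) :
    Module.finrank ℝ E ≤ Fintype.card {i // hA.eigenvalues i < c} := by
  obtain ⟨T, hT⟩ := exists_eigenCoordinates hA
  by_contra! hlt
  let f : E →ₗ[ℝ] ({i // hA.eigenvalues i < c} → ℝ) :=
    LinearMap.funLeft ℝ ℝ Subtype.val ∘ₗ T.toLinearMap ∘ₗ g
  -- By dimension, some nonzero `y` has an image with no component along the eigenvectors for
  -- eigenvalues below `c`; there the form is at least `c|x|²`.
  have hker : LinearMap.ker f ≠ ⊥ := LinearMap.ker_ne_bot_of_finrank_lt (by simpa using hlt)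
  obtain ⟨y, hy, hy0⟩ := Submodule.exists_mem_ne_zero_of_ne_bot hker
  have hz : ∀ i, hA.eigenvalues i < c → T (g y) i = 0 := fun i hi =>
    congrFun (LinearMap.mem_ker.1 hy) ⟨i, hi⟩
  have := hg y hy0
  rw [(hT _).1, (hT _).2, Finset.mul_sum] at this
  refine absurd this (not_lt.2 (Finset.sum_le_sum fun i _ => ?_))
  rcases lt_or_ge (hA.eigenvalues i) c with h | h
  · simp [hz i h]
  · exact mul_le_mul_of_nonneg_right h (sq_nonneg _)

/-- If the quadratic form of `A` is at least `c` on the kernel of a linear map of rank at most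
`k`, then `A` has at most `k` eigenvalues below `c`. -/
theorem card_eigenvalues_lt_le_finrank {A : Matrix V V ℝ} (hA : A.IsHermitian) (c : ℝ)
    {E : Type*} [AddCommGroup E] [Module ℝ E] [FiniteDimensional ℝ E] (f : (V → ℝ) →ₗ[ℝ] E)
    (hf : ∀ x, f x = 0 → c * ∑ i, x i ^ 2 ≤ x ⬝ᵥ A.mulVec x) :
    Fintype.card {i // hA.eigenvalues i < c} ≤ Module.finrank ℝ E := by
  obtain ⟨T, hT⟩ := exists_eigenCoordinates hA
  by_contra! hlt
  -- In eigencoordinates, extension by zero parametrizes the span of the eigenvectors for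
  -- eigenvalues below `c`.
  let ext : ({i // hA.eigenvalues i < c} → ℝ) →ₗ[ℝ] (V → ℝ) :=
    Function.ExtendByZero.linearMap ℝ Subtype.val
  let g := f ∘ₗ T.symm.toLinearMap ∘ₗ ext
  have hker : LinearMap.ker g ≠ ⊥ := LinearMap.ker_ne_bot_of_finrank_lt (by simpa using hlt)
  obtain ⟨z, hz, hz0⟩ := Submodule.exists_mem_ne_zero_of_ne_bot hker
  have hx := hf (T.symm (ext z)) (LinearMap.mem_ker.1 hz)
  rw [(hT _).1, (hT _).2, Finset.mul_sum] at hx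
  simp only [LinearEquiv.apply_symm_apply] at hx
  have hin : ∀ j : {i // hA.eigenvalues i < c}, ext z j = z j := fun j =>
    Subtype.val_injective.extend_apply z 0 j
  have hout : ∀ i, ¬ hA.eigenvalues i < c → ext z i = 0 := fun i hi =>
    Function.extend_apply' _ _ _ (by rintro ⟨j, rfl⟩; exact hi j.2)
  obtain ⟨j, hj⟩ := Function.ne_iff.1 hz0
  refine absurd hx (not_le.2 (Finset.sum_lt_sum (fun i _ => ?_) ⟨j, Finset.mem_univ _, ?_⟩))
  · by_cases h : hA.eigenvalues i < c
    · exact mul_le_mul_of_nonneg_right h.le (sq_nonneg _)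
    · simp [hout i h]
  · rw [hin]
    have : 0 < z j ^ 2 := sq_pos_of_ne_zero hj
    exact mul_lt_mul_of_pos_right j.2 this

end Spectral

/-! ### Eigenvalues of `G` near `n` through the Laplacian form of the complement. -/

section LapCount

variable {V : Type*} [Fintype V] [DecidableEq V] (G : SimpleGraph V) [DecidableRel G.Adj]

/-- The Laplacian quadratic form of the complement of `G`. -/
noncomputable def complForm (x : V → ℝ) : ℝ :=
  (∑ i, ∑ j, if Gᶜ.Adj i j then (x i - x j) ^ 2 else 0) / 2

theorem complForm_nonneg (x : V → ℝ) : 0 ≤ complForm G x := by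
  unfold complForm
  have : 0 ≤ ∑ i, ∑ j, if Gᶜ.Adj i j then (x i - x j) ^ 2 else 0 :=
    Finset.sum_nonneg fun i _ => Finset.sum_nonneg fun j _ => by split_ifs <;> positivity
  positivity

/-- The edges of `G` and of `Gᶜ` together are all pairs, and the Laplacian of the complete graph is
`nI - J`. -/
theorem lapMatrix_form (x : V → ℝ) :
    x ⬝ᵥ (G.lapMatrix ℝ).mulVec x =
      Fintype.card V * ∑ i, x i ^ 2 - (∑ i, x i) ^ 2 - complForm G x := by
  have h1 := G.lapMatrix_toLinearMap₂' ℝ x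
  rw [Matrix.toLinearMap₂'_apply'] at h1
  have h2 : (∑ i, ∑ j, if G.Adj i j then (x i - x j) ^ 2 else 0) +
      (∑ i, ∑ j, if Gᶜ.Adj i j then (x i - x j) ^ 2 else 0) = ∑ i, ∑ j, (x i - x j) ^ 2 := by
    rw [← Finset.sum_add_distrib]
    refine Finset.sum_congr rfl fun i _ => ?_
    rw [← Finset.sum_add_distrib]
    refine Finset.sum_congr rfl fun j _ => ?_
    by_cases hij : i = j
    · subst hij; simp
    · by_cases h : G.Adj i j <;> simp [h, hij]
  have h3 : ∑ i, ∑ j, (x i - x j) ^ 2 =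
      2 * (Fintype.card V * ∑ i, x i ^ 2) - 2 * (∑ i, x i) ^ 2 := by
    simp only [sub_sq, Finset.sum_add_distrib, Finset.sum_sub_distrib, Finset.sum_const,
      Finset.card_univ, nsmul_eq_mul, ← Finset.mul_sum, ← Finset.sum_mul]
    ring
  rw [h1, complForm]
  linarith

/-- Both terms subtracted in `lapMatrix_form` are nonnegative; evaluate at a unit eigenvector. This
makes `[c, n]` and `(-∞, c)` exhaust the spectrum. -/
theorem eigenvalues_le_card (i : V) :
    (G.isHermitian_lapMatrix ℝ).eigenvalues i ≤ Fintype.card V := by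
  set hA := G.isHermitian_lapMatrix ℝ
  obtain ⟨T, hT⟩ := exists_eigenCoordinates hA
  have h := hT (T.symm (Pi.single i 1))
  simp only [LinearEquiv.apply_symm_apply] at h
  have e1 : ∑ j, (Pi.single i (1 : ℝ) : V → ℝ) j ^ 2 = 1 := by
    rw [Finset.sum_eq_single i] <;> simp +contextual
  have e2 : ∑ j, hA.eigenvalues j * (Pi.single i (1 : ℝ) : V → ℝ) j ^ 2 = hA.eigenvalues i := by
    rw [Finset.sum_eq_single i] <;> simp +contextual
  rw [e1, e2, lapMatrix_form] at h
  rw [← h.2, h.1]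
  have := complForm_nonneg G (T.symm (Pi.single i 1))
  have := sq_nonneg (∑ j, (T.symm (Pi.single i (1 : ℝ))) j)
  linarith

theorem lapCount_add_card_lt (c : ℝ) :
    lapCount G (Set.Icc c (Fintype.card V)) +
      Fintype.card {i // (G.isHermitian_lapMatrix ℝ).eigenvalues i < c} = Fintype.card V := by
  have h := Fintype.card_congr (Equiv.sumCompl
    fun i => (G.isHermitian_lapMatrix ℝ).eigenvalues i < c)
  rw [Fintype.card_sum, add_comm] at h
  refine Eq.trans ?_ h
  unfold lapCount
  rw [Nat.card_eq_fintype_card]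
  congr 1
  refine Fintype.card_congr (Equiv.subtypeEquivRight fun i => ?_)
  simp [eigenvalues_le_card]

/-- Upper bound for `lapCount`: a copy of a graph with edges `L` in the complement of `G`, and a
space of zero-sum vectors on it, parametrized by `B`, where its Laplacian form exceeds `c`. -/
theorem lapCount_add_le {m k : ℕ} (φ : Fin m → V) (hφ : Function.Injective φ)
    (L : Finset (Fin m × Fin m)) (hL : ∀ p ∈ L, p.1 < p.2 ∧ ¬ G.Adj (φ p.1) (φ p.2))
    (B : Matrix (Fin m) (Fin k) ℝ) (c : ℝ) (hc : c < Fintype.card V)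
    (hB : ∀ y, ∑ i, B.mulVec y i = 0)
    (hpos : ∀ y, c * ∑ i, B.mulVec y i ^ 2 ≥
      ∑ p ∈ L, (B.mulVec y p.1 - B.mulVec y p.2) ^ 2 → y = 0)
    (hcard : 0 < Fintype.card V) :
    lapCount G (Set.Icc (Fintype.card V - c) (Fintype.card V)) + (k + 1) ≤ Fintype.card V := by
  have hdim : Module.finrank ℝ ((Fin k → ℝ) × ℝ) = k + 1 := by simp
  let ext : (Fin m → ℝ) →ₗ[ℝ] (V → ℝ) := Function.ExtendByZero.linearMap ℝ φ
  have hin : ∀ w i, ext w (φ i) = w i := fun w i => hφ.extend_apply w 0 i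
  have hout : ∀ w v, v ∉ Set.range φ → ext w v = 0 := fun w v hv =>
    Function.extend_apply' _ _ _ (by simpa using hv)
  have hsum : ∀ w, ∑ v, ext w v = ∑ i, w i := fun w => by
    rw [← Fintype.sum_of_injective φ hφ w (ext w) (fun v hv => hout w v hv)
      (fun i => (hin w i).symm)]
  have hsq : ∀ w, ∑ v, ext w v ^ 2 = ∑ i, w i ^ 2 := fun w => by
    rw [← Fintype.sum_of_injective φ hφ (fun i => w i ^ 2) (fun v => ext w v ^ 2)
      (fun v hv => by simp [hout w v hv]) (fun i => by simp [hin])]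
  -- The constants are adjoined to the test space: they do not affect the complement form, are
  -- orthogonal to zero-sum vectors and lie in the kernel of `L(G)`. They account for the `1` in `k
  -- + 1`.
  let g : ((Fin k → ℝ) × ℝ) →ₗ[ℝ] (V → ℝ) :=
    (ext ∘ₗ B.mulVecLin).coprod (LinearMap.toSpanSingleton ℝ (V → ℝ) 1)
  have hgv : ∀ y v, g y v = ext (B.mulVec y.1) v + y.2 := fun y v => by simp [g]
  have hform : ∀ y : (Fin k → ℝ) × ℝ, ∑ p ∈ L, (B.mulVec y.1 p.1 - B.mulVec y.1 p.2) ^ 2 ≤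
      complForm G (g y) := by
    intro y
    let F : V × V → ℝ := fun q => if Gᶜ.Adj q.1 q.2 then (g y q.1 - g y q.2) ^ 2 else 0
    have hF0 : ∀ q, 0 ≤ F q := fun q => by simp only [F]; split_ifs <;> positivity
    have hsymm : ∀ q, F q.swap = F q := fun q => by
      simp only [F, Prod.fst_swap, Prod.snd_swap, SimpleGraph.adj_comm Gᶜ q.2 q.1]
      split_ifs <;> ring
    have hval : ∀ p ∈ L, F (φ p.1, φ p.2) = (B.mulVec y.1 p.1 - B.mulVec y.1 p.2) ^ 2 := by
      intro p hp
      have h : Gᶜ.Adj (φ p.1) (φ p.2) := by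
        rw [SimpleGraph.compl_adj]
        exact ⟨hφ.ne (hL p hp).1.ne, (hL p hp).2⟩
      simp only [F, h, if_true, hgv, hin]
      ring
    -- `complForm` is half a sum over ordered pairs, so every edge in `L` must be counted in both
    -- orientations, `L'` and `L''`.
    let L' : Finset (V × V) := L.map ⟨Prod.map φ φ, hφ.prodMap hφ⟩
    let L'' : Finset (V × V) := L'.map ⟨Prod.swap, Prod.swap_injective⟩
    have hdisj : Disjoint L' L'' := by
      rw [Finset.disjoint_left]
      intro q h1 h2
      simp only [L'', L', Finset.mem_map, Function.Embedding.coeFn_mk] at h1 h2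
      obtain ⟨p, hp, rfl⟩ := h1
      obtain ⟨_, ⟨r, hr, rfl⟩, h⟩ := h2
      simp only [Prod.map, Prod.swap, Prod.mk.injEq, hφ.eq_iff] at h
      have := (hL p hp).1
      have := (hL r hr).1
      rw [h.1, h.2] at this
      order
    have e1 : ∑ q ∈ L', F q = ∑ p ∈ L, (B.mulVec y.1 p.1 - B.mulVec y.1 p.2) ^ 2 := by
      simp only [L', Finset.sum_map, Function.Embedding.coeFn_mk]
      exact Finset.sum_congr rfl fun p hp => hval p hp
    have e2 : ∑ q ∈ L'', F q = ∑ q ∈ L', F q := by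
      simp only [L'', Finset.sum_map _ (⟨Prod.swap, _⟩ : V × V ↪ V × V),
        Function.Embedding.coeFn_mk, hsymm]
    have e3 : ∑ q ∈ L', F q + ∑ q ∈ L'', F q ≤ ∑ q, F q := by
      rw [← Finset.sum_union hdisj]
      exact Finset.sum_le_sum_of_subset_of_nonneg (Finset.subset_univ _) fun q _ _ => hF0 q
    rw [Fintype.sum_prod_type] at e3
    unfold complForm
    simp only [F] at e3
    linarith
  have hlow := finrank_le_card_eigenvalues_lt (G.isHermitian_lapMatrix ℝ) (Fintype.card V - c) g
    (fun y hy => ?_)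
  · have := lapCount_add_card_lt G (Fintype.card V - c)
    omega
  · have hn : (0 : ℝ) < Fintype.card V := by exact_mod_cast hcard
    have s1 : ∑ v, g y v = Fintype.card V * y.2 := by
      simp [hgv, Finset.sum_add_distrib, hsum, hB]
    have s2 : ∑ v, g y v ^ 2 = ∑ i, B.mulVec y.1 i ^ 2 + Fintype.card V * y.2 ^ 2 := by
      simp only [hgv, add_sq, Finset.sum_add_distrib, hsq, ← Finset.sum_mul, ← Finset.mul_sum,
        hsum, hB]
      simp
    rw [lapMatrix_form, s1, s2]
    have h1 := hform y
    have h3 : (Fintype.card V - c) * (Fintype.card V * y.2 ^ 2) ≥ 0 := by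
      have : (0 : ℝ) ≤ Fintype.card V - c := by linarith
      positivity
    by_cases hy1 : y.1 = 0
    · have hy2 : y.2 ≠ 0 := fun h => hy (Prod.ext hy1 h)
      have h2 : 0 < (Fintype.card V - c) * (Fintype.card V * y.2 ^ 2) := by
        have : (0 : ℝ) < Fintype.card V - c := by linarith
        positivity
      have h0 : B.mulVec y.1 = 0 := by rw [hy1]; simp
      have := complForm_nonneg G (g y)
      simp only [h0, Pi.zero_apply]
      simp
      nlinarith
    · have h2 := not_le.1 (mt (hpos y.1) hy1)
      nlinarith

/-- Lower bound for `lapCount`: `k` linear conditions forcing the Laplacian form of the complement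
below `c`. -/
theorem le_lapCount_add {k : ℕ} (f : Fin k → (V → ℝ) →ₗ[ℝ] ℝ) (c : ℝ)
    (hf : ∀ x, ∑ i, x i = 0 → (∀ i, f i x = 0) → complForm G x ≤ c * ∑ i, x i ^ 2) :
    Fintype.card V ≤
      lapCount G (Set.Icc (Fintype.card V - c) (Fintype.card V)) + (k + 1) := by
  have hdim : Module.finrank ℝ ((Fin k → ℝ) × ℝ) = k + 1 := by simp
  -- The sum of the coordinates is the additional functional: it removes the `(∑ xᵢ)²` term.
  have h := card_eigenvalues_lt_le_finrank (G.isHermitian_lapMatrix ℝ) (Fintype.card V - c)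
    ((LinearMap.pi f).prod (∑ i, LinearMap.proj i)) (fun x hx => ?_)
  · have := lapCount_add_card_lt G (Fintype.card V - c)
    omega
  · rw [LinearMap.prod_apply, Function.prod_apply, Prod.mk_eq_zero] at hx
    have h0 : ∑ i, x i = 0 := by simpa using hx.2
    have := hf x h0 (fun i => congrFun hx.1 i)
    rw [lapMatrix_form, h0]
    linarith

/-- If `x` vanishes on `A`, is constant along the edges of the complement that avoid `A`, and no
vertex outside `A` has two non-neighbours in `A`, then the complement form is at most `|x|²`. -/
theorem complForm_le_sum_sq (A : Finset V) (x : V → ℝ) (hA : ∀ a ∈ A, x a = 0)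
    (h1 : ∀ i j, i ∉ A → j ∉ A → i ≠ j → G.Adj i j ∨ x i = x j)
    (h2 : ∀ j, j ∉ A → ∀ a ∈ A, ∀ b ∈ A, ¬ G.Adj a j → ¬ G.Adj b j → a = b) :
    complForm G x ≤ ∑ i, x i ^ 2 := by
  -- An edge of the complement from `i ∈ A` to `j` is charged to `x j ²`. By `h2` each `j` outside
  -- `A` is charged at most once, and for `j ∈ A` the charge is zero.
  let F : V → V → ℝ := fun i j => if i ∈ A ∧ Gᶜ.Adj i j then x j ^ 2 else 0
  have hpt : ∀ i j, (if Gᶜ.Adj i j then (x i - x j) ^ 2 else 0) ≤ F i j + F j i := by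
    intro i j
    have n1 : 0 ≤ F i j := by simp only [F]; split_ifs <;> positivity
    have n2 : 0 ≤ F j i := by simp only [F]; split_ifs <;> positivity
    split_ifs with h
    · by_cases hi : i ∈ A
      · have : F i j = x j ^ 2 := by simp only [F, hi, h, and_self, if_true]
        rw [hA i hi, zero_sub, neg_sq]; linarith
      · by_cases hj : j ∈ A
        · have : F j i = x i ^ 2 := by simp only [F, hj, h.symm, and_self, if_true]
          rw [hA j hj, sub_zero]; linarith
        · rcases h1 i j hi hj h.ne with h' | h'
          · exact absurd h' (by rw [SimpleGraph.compl_adj] at h; exact h.2)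
          · rw [h', sub_self]; simp; linarith
    · linarith
  have hcol : ∀ j, ∑ i, F i j ≤ x j ^ 2 := by
    intro j
    by_cases hj : j ∈ A
    · simp [F, hA j hj]
    · have hc : (Finset.univ.filter fun i => i ∈ A ∧ Gᶜ.Adj i j).card ≤ 1 := by
        rw [Finset.card_le_one]
        intro a ha b hb
        simp only [Finset.mem_filter, Finset.mem_univ, true_and, SimpleGraph.compl_adj] at ha hb
        exact h2 j hj a ha.1 b hb.1 ha.2.2 hb.2.2
      simp only [F, ← Finset.sum_filter, Finset.sum_const, nsmul_eq_mul]
      have hc' : ((Finset.univ.filter fun i => i ∈ A ∧ Gᶜ.Adj i j).card : ℝ) ≤ 1 := by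
        exact_mod_cast hc
      nlinarith [sq_nonneg (x j)]
  have htot : ∑ i, ∑ j, F i j ≤ ∑ i, x i ^ 2 := by
    rw [Finset.sum_comm]
    exact Finset.sum_le_sum fun j _ => hcol j
  have hall : (∑ i, ∑ j, if Gᶜ.Adj i j then (x i - x j) ^ 2 else 0) ≤
      ∑ i, ∑ j, F i j + ∑ i, ∑ j, F j i := by
    rw [← Finset.sum_add_distrib]
    refine Finset.sum_le_sum fun i _ => ?_
    rw [← Finset.sum_add_distrib]
    exact Finset.sum_le_sum fun j _ => hpt i j
  rw [Finset.sum_comm (f := fun i j => F j i)] at hall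
  unfold complForm
  linarith

theorem complForm_eq_zero (x : V → ℝ) (h : ∀ i j, i ≠ j → G.Adj i j ∨ x i = x j) :
    complForm G x = 0 := by
  unfold complForm
  rw [Finset.sum_eq_zero, zero_div]
  refine fun i _ => Finset.sum_eq_zero fun j _ => ?_
  split_ifs with hij
  · rw [SimpleGraph.compl_adj] at hij
    rw [(h i j hij.1).resolve_left hij.2]
    ring
  · rfl

end LapCount

/-! ### Small subgraphs of the complement and the eigenvalues they force. -/

section Forbidden

variable {V : Type*} [Fintype V] [DecidableEq V] {G : SimpleGraph V} [DecidableRel G.Adj]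

/-- A graph in the complement of `G`, given by `φ` and the edge list `L`, carrying a
`k`-dimensional space of zero-sum vectors with large Laplacian form, bounds `lapCount`. -/
theorem lapCount_add_le_of_copy {m k : ℕ} (φ : Fin m → V) (hφ : (List.ofFn φ).Nodup)
    (L : Finset (Fin m × Fin m)) (hL : ∀ p ∈ L, p.1 < p.2) (hadj : ∀ p ∈ L, Gᶜ.Adj (φ p.1) (φ p.2))
    (B : Matrix (Fin m) (Fin k) ℝ) (c : ℝ) (hc : c ≤ 1) (hcard : 2 ≤ Fintype.card V)
    (hB : ∀ y, ∑ i, B.mulVec y i = 0)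
    (hpos : ∀ y, c * ∑ i, B.mulVec y i ^ 2 ≥
      ∑ p ∈ L, (B.mulVec y p.1 - B.mulVec y p.2) ^ 2 → y = 0) :
    lapCount G (Set.Icc (Fintype.card V - c) (Fintype.card V)) + (k + 1) ≤ Fintype.card V := by
  have h2 : (2 : ℝ) ≤ Fintype.card V := by exact_mod_cast hcard
  refine lapCount_add_le G φ (List.nodup_ofFn.1 hφ) L (fun p hp => ⟨hL p hp, ?_⟩) B c
    (by linarith) hB hpos (by omega)
  have := hadj p hp
  rw [SimpleGraph.compl_adj] at this
  exact this.2

/-- The empty subgraph: only the constants contribute, with eigenvalue `0`. -/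
theorem lapCount_add_one_le (c : ℝ) (hc : c ≤ 1) (hcard : 2 ≤ Fintype.card V) :
    lapCount G (Set.Icc (Fintype.card V - c) (Fintype.card V)) + 1 ≤ Fintype.card V :=
  lapCount_add_le_of_copy (k := 0) (m := 0) ![] (by simp) ∅ (by simp) (by simp) 0 c hc hcard
    (by simp) (fun y _ => Subsingleton.elim _ _)

/-- `K₂` has Laplacian eigenvalue `2 > c`, with eigenvector `(1, -1)`; disjoint edges contribute one
such vector each. -/
theorem lapCount_of_edge (c : ℝ) (hc : c ≤ 1) (hcard : 2 ≤ Fintype.card V) {a b : V}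
    (hab : Gᶜ.Adj a b) :
    lapCount G (Set.Icc (Fintype.card V - c) (Fintype.card V)) + 2 ≤ Fintype.card V := by
  refine lapCount_add_le_of_copy (k := 1) ![a, b] ?_ {(0, 1)} (by decide) ?_ !![1; -1] c hc hcard
    ?_ ?_
  · simp [hab.ne]
  · simp [-SimpleGraph.compl_adj, hab]
  · intro y
    simp [Matrix.mulVec, Fin.sum_univ_succ, dotProduct]
  · intro y hy
    simp [Matrix.mulVec, Fin.sum_univ_succ, dotProduct] at hy
    ext i
    fin_cases i
    simp
    nlinarith [sq_nonneg (y 0)]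

theorem lapCount_of_two_disjoint_edges (c : ℝ) (hc : c ≤ 1) (hcard : 2 ≤ Fintype.card V)
    {a b c' d : V} (hab : Gᶜ.Adj a b) (hcd : Gᶜ.Adj c' d) (hac : a ≠ c') (had : a ≠ d)
    (hbc : b ≠ c') (hbd : b ≠ d) :
    lapCount G (Set.Icc (Fintype.card V - c) (Fintype.card V)) + 3 ≤ Fintype.card V := by
  refine lapCount_add_le_of_copy (k := 2) ![a, b, c', d] ?_ {(0, 1), (2, 3)} (by decide) ?_
    !![1, 0; -1, 0; 0, 1; 0, -1] c hc hcard ?_ ?_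
  · simp [List.ofFn_succ, hab.ne, hcd.ne, *]
  · simp [-SimpleGraph.compl_adj, hab, hcd]
  · intro y
    simp [Matrix.mulVec, Fin.sum_univ_succ, dotProduct]
  · intro y hy
    simp [Matrix.mulVec, Fin.sum_univ_succ, dotProduct] at hy
    have h0 : y 0 = 0 := by nlinarith [sq_nonneg (y 0), sq_nonneg (y 1)]
    have h1 : y 1 = 0 := by nlinarith [sq_nonneg (y 0), sq_nonneg (y 1)]
    ext i
    fin_cases i <;> assumption

theorem lapCount_of_three_disjoint_edges (c : ℝ) (hc : c ≤ 1) (hcard : 2 ≤ Fintype.card V)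
    {a b c' d e f : V} (hab : Gᶜ.Adj a b) (hcd : Gᶜ.Adj c' d) (hef : Gᶜ.Adj e f) (hac : a ≠ c')
    (had : a ≠ d) (hbc : b ≠ c') (hbd : b ≠ d) (hae : a ≠ e) (haf : a ≠ f) (hbe : b ≠ e)
    (hbf : b ≠ f) (hce : c' ≠ e) (hcf : c' ≠ f) (hde : d ≠ e) (hdf : d ≠ f) :
    lapCount G (Set.Icc (Fintype.card V - c) (Fintype.card V)) + 4 ≤ Fintype.card V := by
  refine lapCount_add_le_of_copy (k := 3) ![a, b, c', d, e, f] ?_ {(0, 1), (2, 3), (4, 5)}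
    (by decide) ?_ !![1, 0, 0; -1, 0, 0; 0, 1, 0; 0, -1, 0; 0, 0, 1; 0, 0, -1] c hc hcard ?_ ?_
  · simp [List.ofFn_succ, hab.ne, hcd.ne, hef.ne, *]
  · simp [-SimpleGraph.compl_adj, hab, hcd, hef]
  · intro y
    simp [Matrix.mulVec, Fin.sum_univ_succ, dotProduct]
  · intro y hy
    simp [Matrix.mulVec, Fin.sum_univ_succ, dotProduct] at hy
    have h0 : y 0 = 0 := by nlinarith [sq_nonneg (y 0), sq_nonneg (y 1), sq_nonneg (y 2)]
    have h1 : y 1 = 0 := by nlinarith [sq_nonneg (y 0), sq_nonneg (y 1), sq_nonneg (y 2)]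
    have h2 : y 2 = 0 := by nlinarith [sq_nonneg (y 0), sq_nonneg (y 1), sq_nonneg (y 2)]
    ext i
    fin_cases i <;> assumption

/-- The Laplacian of `K₃` is `3` on all zero-sum vectors. -/
theorem lapCount_of_triangle (hcard : 2 ≤ Fintype.card V) {a b c : V} (hab : Gᶜ.Adj a b)
    (hbc : Gᶜ.Adj b c) (hac : Gᶜ.Adj a c) :
    lapCount G (Set.Icc (Fintype.card V - 1) (Fintype.card V)) + 3 ≤ Fintype.card V := by
  refine lapCount_add_le_of_copy (k := 2) ![a, b, c] ?_ {(0, 1), (1, 2), (0, 2)}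
    (by decide) ?_ !![1, 0; 0, 1; -1, -1] 1 le_rfl hcard ?_ ?_
  · simp [List.ofFn_succ, hab.ne, hac.ne, hbc.ne]
  · simp [-SimpleGraph.compl_adj, hab, hbc, hac]
  · intro y
    simp [Matrix.mulVec, Fin.sum_univ_succ, dotProduct]
  · intro y hy
    simp [Matrix.mulVec, Fin.sum_univ_succ, dotProduct] at hy
    have h0 : y 0 = 0 := by nlinarith [sq_nonneg (y 0 + y 1), sq_nonneg (y 0), sq_nonneg (y 1)]
    have h1 : y 1 = 0 := by nlinarith [sq_nonneg (y 0 + y 1), sq_nonneg (y 0), sq_nonneg (y 1)]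
    ext i
    fin_cases i <;> assumption

theorem lapCount_of_triangle_of_disjoint_edge (hcard : 2 ≤ Fintype.card V) {a b c d e : V}
    (hab : Gᶜ.Adj a b) (hbc : Gᶜ.Adj b c) (hac : Gᶜ.Adj a c) (hde : Gᶜ.Adj d e) (had : a ≠ d)
    (hae : a ≠ e) (hbd : b ≠ d) (hbe : b ≠ e) (hcd : c ≠ d) (hce : c ≠ e) :
    lapCount G (Set.Icc (Fintype.card V - 1) (Fintype.card V)) + 4 ≤ Fintype.card V := by
  refine lapCount_add_le_of_copy (k := 3) ![a, b, c, d, e] ?_ {(0, 1), (1, 2), (0, 2), (3, 4)}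
    (by decide) ?_ !![1, 0, 0; 0, 1, 0; -1, -1, 0; 0, 0, 1; 0, 0, -1] 1 le_rfl hcard ?_ ?_
  · simp [List.ofFn_succ, hab.ne, hac.ne, hbc.ne, hde.ne, *]
  · simp [-SimpleGraph.compl_adj, hab, hbc, hac, hde]
  · intro y
    simp [Matrix.mulVec, Fin.sum_univ_succ, dotProduct]
  · intro y hy
    simp [Matrix.mulVec, Fin.sum_univ_succ, dotProduct] at hy
    have p := sq_nonneg (y 0 + y 1)
    have p0 := sq_nonneg (y 0)
    have p1 := sq_nonneg (y 1)
    have p2 := sq_nonneg (y 2)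
    have h0 : y 0 = 0 := by nlinarith
    have h1 : y 1 = 0 := by nlinarith
    have h2 : y 2 = 0 := by nlinarith
    ext i
    fin_cases i <;> assumption

/-- The columns of `B` are eigenvectors of `C₄` for the eigenvalues `2, 2, 4`. -/
theorem lapCount_of_four_cycle (hcard : 2 ≤ Fintype.card V) {a b c d : V}
    (hab : Gᶜ.Adj a b) (hbc : Gᶜ.Adj b c) (hcd : Gᶜ.Adj c d) (hda : Gᶜ.Adj d a) (hac : a ≠ c)
    (hbd : b ≠ d) :
    lapCount G (Set.Icc (Fintype.card V - 1) (Fintype.card V)) + 4 ≤ Fintype.card V := by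
  refine lapCount_add_le_of_copy (k := 3) ![a, b, c, d] ?_ {(0, 1), (1, 2), (2, 3), (0, 3)}
    (by decide) ?_ !![1, 0, 1; 0, 1, -1; -1, 0, 1; 0, -1, -1] 1 le_rfl hcard ?_ ?_
  · simp [List.ofFn_succ, hab.ne, hda.ne', hbc.ne, hcd.ne, *]
  · simp [-SimpleGraph.compl_adj, hab, hbc, hcd, hda.symm]
  · intro y
    simp [Matrix.mulVec, Fin.sum_univ_succ, dotProduct]
    ring
  · intro y hy
    simp [Matrix.mulVec, Fin.sum_univ_succ, dotProduct] at hy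
    have p0 := sq_nonneg (y 0)
    have p1 := sq_nonneg (y 1)
    have p2 := sq_nonneg (y 2)
    have h0 : y 0 = 0 := by nlinarith
    have h1 : y 1 = 0 := by nlinarith
    have h2 : y 2 = 0 := by nlinarith
    ext i
    fin_cases i <;> assumption

/-- Three eigenvalues of `P₅` exceed `1`. Instead of the irrational eigenvectors, `B` uses a basis
of the zero-sum vectors symmetric under reversal and one antisymmetric vector. -/
theorem lapCount_of_path_five (hcard : 2 ≤ Fintype.card V) {a b c d e : V}
    (hab : Gᶜ.Adj a b) (hbc : Gᶜ.Adj b c) (hcd : Gᶜ.Adj c d) (hde : Gᶜ.Adj d e) (hac : a ≠ c)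
    (had : a ≠ d) (hae : a ≠ e) (hbd : b ≠ d) (hbe : b ≠ e) (hce : c ≠ e) :
    lapCount G (Set.Icc (Fintype.card V - 1) (Fintype.card V)) + 4 ≤ Fintype.card V := by
  refine lapCount_add_le_of_copy (k := 3) ![a, b, c, d, e] ?_ {(0, 1), (1, 2), (2, 3), (3, 4)}
    (by decide) ?_ !![1, 0, 1; 0, 1, -1; -2, -2, 0; 0, 1, 1; 1, 0, -1] 1 le_rfl hcard ?_ ?_
  · simp [List.ofFn_succ, hab.ne, hbc.ne, hcd.ne, hde.ne, *]
  · simp [-SimpleGraph.compl_adj, hab, hbc, hcd, hde]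
  · intro y
    simp [Matrix.mulVec, Fin.sum_univ_succ, dotProduct]
    ring
  · intro y hy
    simp [Matrix.mulVec, Fin.sum_univ_succ, dotProduct] at hy
    -- The form minus `|x|²` equals `(2y₀ + 3y₁)² + 5y₁² + 6y₂²`.
    have p0 := sq_nonneg (2 * y 0 + 3 * y 1)
    have p1 := sq_nonneg (y 1)
    have p2 := sq_nonneg (y 2)
    have h2 : y 2 = 0 := by nlinarith
    have h1 : y 1 = 0 := by nlinarith
    have h0 : y 0 = 0 := by rw [h1, h2] at hy; nlinarith [sq_nonneg (y 0)]
    ext i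
    fin_cases i <;> assumption

/-- For `c = 0` only the rank of the complement Laplacian matters: a forest with `k` edges is
positive definite on a `k`-dimensional space of zero-sum vectors, so any basis of it serves as `B`.
The same applies to the three-edge forests below. -/
theorem lapCount_zero_of_path_three (hcard : 2 ≤ Fintype.card V) {a b c : V} (hab : Gᶜ.Adj a b)
    (hbc : Gᶜ.Adj b c) (hac : a ≠ c) :
    lapCount G (Set.Icc (Fintype.card V - 0) (Fintype.card V)) + 3 ≤ Fintype.card V := by
  refine lapCount_add_le_of_copy (k := 2) ![a, b, c] ?_ {(0, 1), (1, 2)}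
    (by decide) ?_ !![1, 1; 0, -2; -1, 1] 0 zero_le_one hcard ?_ ?_
  · simp [List.ofFn_succ, hab.ne, hac, hbc.ne]
  · simp [-SimpleGraph.compl_adj, hab, hbc]
  · intro y
    simp [Matrix.mulVec, Fin.sum_univ_succ, dotProduct]
    ring
  · intro y hy
    simp [Matrix.mulVec, Fin.sum_univ_succ, dotProduct] at hy
    have h0 : y 0 = 0 := by nlinarith [sq_nonneg (y 0), sq_nonneg (y 1)]
    have h1 : y 1 = 0 := by nlinarith [sq_nonneg (y 0), sq_nonneg (y 1)]
    ext i
    fin_cases i <;> assumption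

theorem lapCount_zero_of_path_four (hcard : 2 ≤ Fintype.card V) {a b c d : V} (hab : Gᶜ.Adj a b)
    (hbc : Gᶜ.Adj b c) (hcd : Gᶜ.Adj c d) (hac : a ≠ c) (had : a ≠ d) (hbd : b ≠ d) :
    lapCount G (Set.Icc (Fintype.card V - 0) (Fintype.card V)) + 4 ≤ Fintype.card V := by
  refine lapCount_add_le_of_copy (k := 3) ![a, b, c, d] ?_ {(0, 1), (1, 2), (2, 3)}
    (by decide) ?_ !![1, 0, 1; 1, 0, -1; -1, 1, 0; -1, -1, 0] 0 zero_le_one hcard ?_ ?_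
  · simp [List.ofFn_succ, hab.ne, hbc.ne, hcd.ne, *]
  · simp [-SimpleGraph.compl_adj, hab, hbc, hcd]
  · intro y
    simp [Matrix.mulVec, Fin.sum_univ_succ, dotProduct]
    ring
  · intro y hy
    simp [Matrix.mulVec, Fin.sum_univ_succ, dotProduct] at hy
    have p1 := sq_nonneg (y 1)
    have p2 := sq_nonneg (y 2)
    have p := sq_nonneg (y 0 + -y 2 - (-y 0 + y 1))
    have h1 : y 1 = 0 := by nlinarith
    have h2 : y 2 = 0 := by nlinarith
    have h0 : y 0 = 0 := by rw [h1, h2] at hy; nlinarith [sq_nonneg (y 0)]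
    ext i
    fin_cases i <;> assumption

theorem lapCount_zero_of_claw (hcard : 2 ≤ Fintype.card V) {a b c d : V} (hab : Gᶜ.Adj a b)
    (hac : Gᶜ.Adj a c) (had : Gᶜ.Adj a d) (hbc : b ≠ c) (hbd : b ≠ d) (hcd : c ≠ d) :
    lapCount G (Set.Icc (Fintype.card V - 0) (Fintype.card V)) + 4 ≤ Fintype.card V := by
  refine lapCount_add_le_of_copy (k := 3) ![a, b, c, d] ?_ {(0, 1), (0, 2), (0, 3)}
    (by decide) ?_ !![0, 0, 3; 1, 0, -1; 0, 1, -1; -1, -1, -1] 0 zero_le_one hcard ?_ ?_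
  · simp [List.ofFn_succ, hab.ne, hac.ne, had.ne, *]
  · simp [-SimpleGraph.compl_adj, hab, hac, had]
  · intro y
    simp [Matrix.mulVec, Fin.sum_univ_succ, dotProduct]
    ring
  · intro y hy
    simp [Matrix.mulVec, Fin.sum_univ_succ, dotProduct] at hy
    have p0 := sq_nonneg (y 0)
    have p1 := sq_nonneg (y 1)
    have p2 := sq_nonneg (y 2)
    have p := sq_nonneg (y 0 + y 1)
    have h0 : y 0 = 0 := by nlinarith
    have h1 : y 1 = 0 := by nlinarith
    have h2 : y 2 = 0 := by nlinarith
    ext i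
    fin_cases i <;> assumption

theorem lapCount_zero_of_path_three_of_disjoint_edge (hcard : 2 ≤ Fintype.card V)
    {a b c d e : V} (hab : Gᶜ.Adj a b) (hbc : Gᶜ.Adj b c) (hde : Gᶜ.Adj d e) (hac : a ≠ c)
    (had : a ≠ d) (hae : a ≠ e) (hbd : b ≠ d) (hbe : b ≠ e) (hcd : c ≠ d) (hce : c ≠ e) :
    lapCount G (Set.Icc (Fintype.card V - 0) (Fintype.card V)) + 4 ≤ Fintype.card V := by
  refine lapCount_add_le_of_copy (k := 3) ![a, b, c, d, e] ?_ {(0, 1), (1, 2), (3, 4)}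
    (by decide) ?_ !![1, 1, 0; 0, -2, 0; -1, 1, 0; 0, 0, 1; 0, 0, -1] 0 zero_le_one hcard ?_ ?_
  · simp [List.ofFn_succ, hab.ne, hbc.ne, hde.ne, *]
  · simp [-SimpleGraph.compl_adj, hab, hbc, hde]
  · intro y
    simp [Matrix.mulVec, Fin.sum_univ_succ, dotProduct]
    ring
  · intro y hy
    simp [Matrix.mulVec, Fin.sum_univ_succ, dotProduct] at hy
    have p0 := sq_nonneg (y 0)
    have p1 := sq_nonneg (y 1)
    have p2 := sq_nonneg (y 2)
    have h0 : y 0 = 0 := by nlinarith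
    have h1 : y 1 = 0 := by nlinarith
    have h2 : y 2 = 0 := by nlinarith
    ext i
    fin_cases i <;> assumption

end Forbidden

/-! ### Graphs without the forbidden subgraphs. -/

section Classification

variable {V : Type*} (C : SimpleGraph V)

/-- `C` has no two disjoint edges. -/
def NoTwoMatching : Prop :=
  ∀ a b c d, C.Adj a b → C.Adj c d → a ≠ c → a ≠ d → b ≠ c → b ≠ d → False

/-- `C` has no triangle. -/
def NoTriangle : Prop := ∀ a b c, C.Adj a b → C.Adj b c → C.Adj a c → False

/-- `C` has no three pairwise disjoint edges. -/
def NoThreeMatching : Prop :=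
  ∀ a b c d e f, C.Adj a b → C.Adj c d → C.Adj e f → a ≠ c → a ≠ d → b ≠ c → b ≠ d →
    a ≠ e → a ≠ f → b ≠ e → b ≠ f → c ≠ e → c ≠ f → d ≠ e → d ≠ f → False

/-- `C` has no path on five vertices. -/
def NoPathFive : Prop :=
  ∀ a b c d e, C.Adj a b → C.Adj b c → C.Adj c d → C.Adj d e → a ≠ c → a ≠ d → a ≠ e → b ≠ d →
    b ≠ e → c ≠ e → False

/-- `C` has no cycle on four vertices. -/
def NoFourCycle : Prop :=
  ∀ a b c d, C.Adj a b → C.Adj b c → C.Adj c d → C.Adj d a → a ≠ c → b ≠ d → False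

/-- `C` has no triangle together with a disjoint edge. -/
def NoTriangleEdge : Prop :=
  ∀ a b c d e, C.Adj a b → C.Adj b c → C.Adj a c → C.Adj d e → a ≠ d → a ≠ e → b ≠ d → b ≠ e →
    c ≠ d → c ≠ e → False

variable {C}

/-- If neither end of an edge `ab` is a centre, one edge avoids `a` and so passes through `b`, and
another avoids `b` and passes through `a`. These two must meet, which closes a triangle. -/
theorem NoTwoMatching.exists_center [Nonempty V] (h : NoTwoMatching C) (h3 : NoTriangle C) :
    ∃ v, ∀ x y, C.Adj x y → x = v ∨ y = v := by
  by_cases hE : ∃ a b, C.Adj a b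
  · obtain ⟨a, b, hab⟩ := hE
    by_contra! hcon
    obtain ⟨x, y, hxy, hx, hy⟩ := hcon a
    obtain ⟨z, w, hzw, hz, hw⟩ := hcon b
    have s1 := hxy.symm
    have s2 := hzw.symm
    have k1 := h a b x y hab hxy hx.symm hy.symm
    have k2 := h a b z w hab hzw
    have k3 := h x y z w hxy hzw
    have t1 : ∀ t, C.Adj b t → C.Adj a t → False := fun t p q => h3 a b t hab p q
    grind +splitImp
  · push Not at hE
    exact ⟨Classical.arbitrary V, fun x y h => absurd h (hE x y)⟩

/-- A triangle with a pendant edge, with the only possible further edges. -/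
theorem edges_of_paw (h3 : NoThreeMatching C) (h5 : NoPathFive C) (h4 : NoFourCycle C)
    {a b c d : V} (hab : C.Adj a b) (hbc : C.Adj b c) (hac : C.Adj a c) (hcd : C.Adj c d)
    (had : a ≠ d) (hbd : b ≠ d) :
    ∀ x y, C.Adj x y → x = c ∨ y = c ∨ s(x, y) = s(a, b) := by
  have nab := hab.ne
  have nbc := hbc.ne
  have nac := hac.ne
  have ncd := hcd.ne
  have hda : ¬ C.Adj d a := fun h => h4 a b c d hab hbc hcd h nac hbd
  have hdb : ¬ C.Adj d b := fun h => h4 b a c d hab.symm hac hcd h nbc had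
  -- A fifth vertex attached anywhere but at `c` would start a path on five vertices.
  have out : ∀ y, y ≠ a → y ≠ b → y ≠ c → y ≠ d →
      ¬ C.Adj y a ∧ ¬ C.Adj y b ∧ ¬ C.Adj y d := by
    intro y ya yb yc yd
    refine ⟨fun h => ?_, fun h => ?_, fun h => ?_⟩
    · exact h5 y a b c d h hab hbc hcd yb yc yd nac had hbd
    · exact h5 y b a c d h hab.symm hac hcd ya yc yd nbc hbd had
    · exact h5 y d c b a h hcd.symm hbc.symm hab.symm yc yb ya hbd.symm had.symm nac.symm
  intro x y hxy
  by_contra! hcon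
  obtain ⟨xc, yc, hs⟩ := hcon
  have hs' : ¬ (x = a ∧ y = b) ∧ ¬ (x = b ∧ y = a) := by
    rw [Ne, Sym2.eq_iff] at hs
    tauto
  have hyx := hxy.symm
  have nxy := hxy.ne
  have key := h3 a b c d x y hab hcd hxy
  grind +splitImp

/-- Pairwise intersecting edges form a star or a triangle, and a triangle is a star plus the
opposite edge. Otherwise consider a path `abcd`: a chord `ac` or `bd` gives a triangle with a
pendant edge, and without one `b` and `c` are the two centres. If there is no such path, two
disjoint edges each have a leaf as an end, and their other ends are the centres. -/
theorem classification [Nontrivial V] (h3 : NoThreeMatching C) (h5 : NoPathFive C)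
    (h4 : NoFourCycle C) (hte : NoTriangleEdge C) :
    (∃ v a b, ∀ x y, C.Adj x y → x = v ∨ y = v ∨ s(x, y) = s(a, b)) ∨
    (∃ v u, v ≠ u ∧ (∀ x y, C.Adj x y → x = v ∨ x = u ∨ y = v ∨ y = u) ∧
      ∀ x, x ≠ v → x ≠ u → C.Adj v x → ¬ C.Adj u x) := by
  by_cases hm : NoTwoMatching C
  · left
    by_cases ht : NoTriangle C
    · obtain ⟨v, hv⟩ := hm.exists_center ht
      exact ⟨v, v, v, fun x y h => (hv x y h).imp_right Or.inl⟩
    · simp only [NoTriangle, not_forall] at ht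
      obtain ⟨a, b, c, hab, hbc, hac, -⟩ := ht
      refine ⟨a, b, c, fun x y hxy => ?_⟩
      have k1 := hm a b x y hab hxy
      have k2 := hm a c x y hac hxy
      have := hab.ne
      have := hbc.ne
      have := hac.ne
      rw [Sym2.eq_iff]
      grind +splitImp
  by_cases hp : ∃ a b c d, C.Adj a b ∧ C.Adj b c ∧ C.Adj c d ∧ a ≠ c ∧ a ≠ d ∧ b ≠ d
  · obtain ⟨a, b, c, d, hab, hbc, hcd, nac, nad, nbd⟩ := hp
    by_cases hac : C.Adj a c
    · exact Or.inl ⟨c, a, b, edges_of_paw h3 h5 h4 hab hbc hac hcd nad nbd⟩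
    by_cases hbd : C.Adj b d
    · exact Or.inl ⟨b, d, c, edges_of_paw h3 h5 h4 hcd.symm hbc.symm hbd.symm hab.symm nad.symm
        nac.symm⟩
    right
    have nab := hab.ne
    have nbc := hbc.ne
    have ncd := hcd.ne
    have hda : ¬ C.Adj d a := fun h => h4 a b c d hab hbc hcd h nac nbd
    have out : ∀ y, y ≠ a → y ≠ b → y ≠ c → y ≠ d →
        ¬ C.Adj y a ∧ ¬ C.Adj y d ∧ ¬ (C.Adj b y ∧ C.Adj c y) := by
      intro y ya yb yc yd
      refine ⟨fun h => ?_, fun h => ?_, fun h => ?_⟩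
      · exact h5 y a b c d h hab hbc hcd yb yc yd nac nad nbd
      · exact h5 y d c b a h hcd.symm hbc.symm hab.symm yc yb ya nbd.symm nad.symm nac.symm
      · exact h5 a b y c d hab h.1 h.2.symm hcd ya.symm nac nad nbc nbd yd
    refine ⟨b, c, nbc, fun x y hxy => ?_, fun x xb xc hbx hcx => ?_⟩
    · by_contra! hcon
      have hyx := hxy.symm
      have nxy := hxy.ne
      have key := h3 a b c d x y hab hcd hxy
      grind +splitImp
    · have hca : ¬ C.Adj c a := fun h => hac h.symm
      grind +splitImp
  · right
    simp only [NoTwoMatching, not_forall] at hm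
    obtain ⟨a, b, c, d, hab, hcd, nac, nad, nbc, nbd, -⟩ := hm
    have hp' : ∀ a b c d, C.Adj a b → C.Adj b c → C.Adj c d → a ≠ c → a ≠ d → b ≠ d → False :=
      fun a b c d h1 h2 h3 h4 h5 h6 => hp ⟨a, b, c, d, h1, h2, h3, h4, h5, h6⟩
    -- Were there further neighbours at both ends, distinct ones would give a path on four vertices.
    -- A common one gives a triangle, which either meets `cd` in such a path or is disjoint from it,
    -- against `hte`.
    have leaf : ∀ a b c d, C.Adj a b → C.Adj c d → a ≠ c → a ≠ d → b ≠ c → b ≠ d →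
        (∀ x, C.Adj b x → x = a) ∨ (∀ x, C.Adj a x → x = b) := by
      intro a b c d hab hcd nac nad nbc nbd
      by_contra! hcon
      obtain ⟨⟨x, hbx, hxa⟩, y, hay, hyb⟩ := hcon
      by_cases hxy : x = y
      · subst hxy
        by_cases hxc : x = c
        · subst hxc
          exact hp' a b x d hab hbx hcd nac nad nbd
        · by_cases hxd : x = d
          · subst hxd
            exact hp' a b x c hab hbx hcd.symm nad nac nbc
          · exact hte a b x c d hab hbx hay hcd nac nad nbc nbd hxc hxd
      · exact hp' y a b x hay.symm hab hbx hyb (Ne.symm hxy) hxa.symm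
    have main : ∀ a b c d, C.Adj a b → C.Adj c d → a ≠ c → a ≠ d → b ≠ c → b ≠ d →
        (∀ x, C.Adj b x → x = a) → (∀ x, C.Adj d x → x = c) →
        (∃ v u, v ≠ u ∧ (∀ x y, C.Adj x y → x = v ∨ x = u ∨ y = v ∨ y = u) ∧
          ∀ x, x ≠ v → x ≠ u → C.Adj v x → ¬ C.Adj u x) := by
      intro a b c d hab hcd nac nad nbc nbd hb hd
      refine ⟨a, c, nac, fun x y hxy => ?_, fun x xa xc hax hcx => ?_⟩
      · by_contra! hcon
        have hyx := hxy.symm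
        have key := h3 a b c d x y hab hcd hxy
        clear leaf hp hp' hte
        grind +splitImp
      · have hbx : b ≠ x := by
          rintro rfl
          exact nac (hb c hcx.symm).symm
        exact hp' b a x c hab.symm hax hcx.symm hbx nbc nac
    rcases leaf a b c d hab hcd nac nad nbc nbd with hb | ha <;>
    rcases leaf c d a b hcd hab nac.symm nbc.symm nad.symm nbd.symm with hd | hc
    · exact main a b c d hab hcd nac nad nbc nbd hb hd
    · exact main a b d c hab hcd.symm nad nac nbd nbc hb hc
    · exact main b a c d hab.symm hcd nbc nbd nac nad ha hd
    · exact main b a d c hab.symm hcd.symm nbd nbc nad nac ha hc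

/-- If `C` has no acyclic set of three edges, then its edges lie in a triangle or a pair of
disjoint edges. -/
theorem classification_of_no_forest [Nonempty V] (h3 : NoThreeMatching C)
    (h4 : ∀ a b c d, C.Adj a b → C.Adj b c → C.Adj c d → a ≠ c → a ≠ d → b ≠ d → False)
    (hclaw : ∀ a b c d, C.Adj a b → C.Adj a c → C.Adj a d → b ≠ c → b ≠ d → c ≠ d → False)
    (hpe : ∀ a b c d e, C.Adj a b → C.Adj b c → C.Adj d e → a ≠ c → a ≠ d → a ≠ e → b ≠ d →
      b ≠ e → c ≠ d → c ≠ e → False) :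
    (∃ a b c, C.Adj a b ∧ C.Adj b c ∧ a ≠ c ∧ ∀ x y, C.Adj x y →
      s(x, y) = s(a, b) ∨ s(x, y) = s(b, c) ∨ s(x, y) = s(a, c)) ∨
    (∃ a b c d, C.Adj a b ∧ C.Adj c d ∧ a ≠ c ∧ a ≠ d ∧ b ≠ c ∧ b ≠ d ∧ ∀ x y, C.Adj x y →
      s(x, y) = s(a, b) ∨ s(x, y) = s(c, d)) ∨
    (∃ a b, ∀ x y, C.Adj x y → s(x, y) = s(a, b)) := by
  by_cases hp : ∃ a b c, C.Adj a b ∧ C.Adj b c ∧ a ≠ c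
  · left
    obtain ⟨a, b, c, hab, hbc, nac⟩ := hp
    refine ⟨a, b, c, hab, hbc, nac, fun x y hxy => ?_⟩
    have nab := hab.ne
    have nbc := hbc.ne
    have out : ∀ t, t ≠ a → t ≠ b → t ≠ c → ¬ C.Adj t a ∧ ¬ C.Adj t b ∧ ¬ C.Adj t c := by
      intro t ta tb tc
      refine ⟨fun h => ?_, fun h => ?_, fun h => ?_⟩
      · exact h4 t a b c h hab hbc tb tc nac
      · exact hclaw b a c t hab.symm hbc h.symm nac ta.symm tc.symm
      · exact h4 t c b a h hbc.symm hab.symm tb ta nac.symm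
    have key := hpe a b c x y hab hbc hxy nac
    have hyx := hxy.symm
    have nxy := hxy.ne
    simp only [Sym2.eq_iff]
    grind +splitImp
  · push Not at hp
    right
    by_cases hm : NoTwoMatching C
    · right
      by_cases hE : ∃ a b, C.Adj a b
      · obtain ⟨a, b, hab⟩ := hE
        refine ⟨a, b, fun x y hxy => ?_⟩
        have key := hm a b x y hab hxy
        have hyx := hxy.symm
        have hba := hab.symm
        simp only [Sym2.eq_iff]
        grind +splitImp
      · push Not at hE
        exact ⟨Classical.arbitrary V, Classical.arbitrary V, fun x y h => absurd h (hE x y)⟩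
    · left
      simp only [NoTwoMatching, not_forall] at hm
      obtain ⟨a, b, c, d, hab, hcd, nac, nad, nbc, nbd, -⟩ := hm
      refine ⟨a, b, c, d, hab, hcd, nac, nad, nbc, nbd, fun x y hxy => ?_⟩
      have key := h3 a b c d x y hab hcd hxy nac nad nbc nbd
      have hyx := hxy.symm
      have hba := hab.symm
      have hdc := hcd.symm
      simp only [Sym2.eq_iff]
      grind +splitImp

end Classification

/-! ### Eigenvalue counts in terms of the shape of the non-edges. -/

section Counts

variable {V : Type*} [Fintype V] [DecidableEq V] {G : SimpleGraph V} [DecidableRel G.Adj]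

/-- The linear functional `x ↦ x a - x b`. -/
def coordDiff {V : Type*} (a b : V) : (V → ℝ) →ₗ[ℝ] ℝ :=
  (LinearMap.proj a : (V → ℝ) →ₗ[ℝ] ℝ) - (LinearMap.proj b : (V → ℝ) →ₗ[ℝ] ℝ)

/-- The number of Laplacian eigenvalues of `G` that are at least `n - c`. -/
noncomputable abbrev topCount (G : SimpleGraph V) [DecidableRel G.Adj] (c : ℝ) : ℕ :=
  lapCount G (Set.Icc (Fintype.card V - c) (Fintype.card V))

/-- All non-edges of `G` contain one vertex. -/
def NonEdgesStar {V : Type*} (G : SimpleGraph V) : Prop :=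
  ∃ v, ∀ x y, Gᶜ.Adj x y → x = v ∨ y = v

/-- All non-edges of `G` but at most one contain one vertex. -/
def NonEdgesStarEdge {V : Type*} (G : SimpleGraph V) : Prop :=
  ∃ v a b, ∀ x y, Gᶜ.Adj x y → x = v ∨ y = v ∨ s(x, y) = s(a, b)

/-- All non-edges of `G` meet `{v, u}`, and no other vertex has both `v` and `u` as
non-neighbours. -/
def NonEdgesTwoStars {V : Type*} (G : SimpleGraph V) : Prop :=
  ∃ v u, v ≠ u ∧ (∀ x y, Gᶜ.Adj x y → x = v ∨ x = u ∨ y = v ∨ y = u) ∧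
    ∀ x, x ≠ v → x ≠ u → Gᶜ.Adj v x → ¬ Gᶜ.Adj u x

theorem topCount_of_complete (c : ℝ) (hc : 0 ≤ c) (h : ∀ x y, ¬ Gᶜ.Adj x y) :
    Fintype.card V ≤ topCount G c + 1 := by
  refine le_lapCount_add G (k := 0) (fun i => i.elim0) c fun x _ _ => ?_
  rw [complForm_eq_zero]
  · exact mul_nonneg hc (Finset.sum_nonneg fun i _ => sq_nonneg _)
  · intro i j hij
    left
    by_contra hn
    exact h i j ((G.compl_adj i j).2 ⟨hij, hn⟩)

theorem complete_iff_topCount (c : ℝ) (hc : 0 ≤ c) (hc' : c ≤ 1) (hcard : 2 ≤ Fintype.card V) :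
    Fintype.card V ≤ topCount G c + 1 ↔ ∀ x y, ¬ Gᶜ.Adj x y := by
  refine ⟨fun h x y hxy => ?_, topCount_of_complete c hc⟩
  have := lapCount_of_edge c hc' hcard hxy
  simp only [topCount] at h
  omega

/-- One condition suffices for a star, namely `x v = 0` at the centre. The obstructions are `2K₂`
and `K₃`, each with two eigenvalues above `1`. -/
theorem nonEdgesStar_iff_topCount (hcard : 2 ≤ Fintype.card V) :
    Fintype.card V ≤ topCount G 1 + 2 ↔ NonEdgesStar G := by
  constructor
  · intro h
    simp only [topCount] at h
    have : Nonempty V := Fintype.card_pos_iff.1 (by omega)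
    refine NoTwoMatching.exists_center ?_ ?_
    · intro a b c d h1 h2 h3 h4 h5 h6
      have := lapCount_of_two_disjoint_edges 1 le_rfl hcard h1 h2 h3 h4 h5 h6
      omega
    · intro a b c h1 h2 h3
      have := lapCount_of_triangle hcard h1 h2 h3
      omega
  · rintro ⟨v, hv⟩
    refine le_lapCount_add G (k := 1) ![LinearMap.proj v] 1 fun x _ hx => ?_
    have hxv : x v = 0 := by simpa using hx 0
    rw [one_mul]
    refine complForm_le_sum_sq G {v} x (by simpa using hxv) (fun i j hi hj hij => ?_) (by simp)
    left
    by_contra hn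
    have := hv i j ((G.compl_adj i j).2 ⟨hij, hn⟩)
    simp_all

/-- Two conditions suffice: vanishing at the centre and equality along the extra edge, or vanishing
at both centres. In the latter case the absence of common leaves keeps the form below `|x|²`. -/
theorem nonEdges_iff_topCount (hcard : 2 ≤ Fintype.card V) :
    Fintype.card V ≤ topCount G 1 + 3 ↔ NonEdgesStarEdge G ∨ NonEdgesTwoStars G := by
  constructor
  · intro h
    simp only [topCount] at h
    have : Nontrivial V := Fintype.one_lt_card_iff_nontrivial.1 (by omega)
    refine classification ?_ ?_ ?_ ?_
    · intro a b c d e f h1 h2 h3 g1 g2 g3 g4 g5 g6 g7 g8 g9 g10 g11 g12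
      have := lapCount_of_three_disjoint_edges 1 le_rfl hcard h1 h2 h3 g1 g2 g3 g4 g5 g6 g7 g8
        g9 g10 g11 g12
      omega
    · intro a b c d e h1 h2 h3 h4 g1 g2 g3 g4 g5 g6
      have := lapCount_of_path_five hcard h1 h2 h3 h4 g1 g2 g3 g4 g5 g6
      omega
    · intro a b c d h1 h2 h3 h4 g1 g2
      have := lapCount_of_four_cycle hcard h1 h2 h3 h4 g1 g2
      omega
    · intro a b c d e h1 h2 h3 h4 g1 g2 g3 g4 g5 g6
      have := lapCount_of_triangle_of_disjoint_edge hcard h1 h2 h3 h4 g1 g2 g3 g4 g5 g6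
      omega
  · rintro (⟨v, a, b, hv⟩ | ⟨v, u, -, hv, hu⟩)
    · refine le_lapCount_add G (k := 2) ![LinearMap.proj v, coordDiff a b] 1
        fun x _ hx => ?_
      have hxv : x v = 0 := by simpa using hx 0
      have hxab : x a = x b := by simpa [coordDiff, sub_eq_zero] using hx 1
      rw [one_mul]
      refine complForm_le_sum_sq G {v} x (by simpa using hxv) (fun i j hi hj hij => ?_) (by simp)
      by_cases hn : G.Adj i j
      · exact Or.inl hn
      · rcases hv i j ((G.compl_adj i j).2 ⟨hij, hn⟩) with h | h | h
        · simp_all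
        · simp_all
        · rw [Sym2.eq_iff] at h
          rcases h with ⟨rfl, rfl⟩ | ⟨rfl, rfl⟩ <;> simp [hxab]
    · refine le_lapCount_add G (k := 2) ![LinearMap.proj v, LinearMap.proj u] 1
        fun x _ hx => ?_
      have hxv : x v = 0 := by simpa using hx 0
      have hxu : x u = 0 := by simpa using hx 1
      rw [one_mul]
      refine complForm_le_sum_sq G {v, u} x (by simp [hxv, hxu]) (fun i j hi hj hij => ?_) ?_
      · left
        by_contra hn
        have := hv i j ((G.compl_adj i j).2 ⟨hij, hn⟩)
        simp only [Finset.mem_insert, Finset.mem_singleton] at hi hj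
        tauto
      · intro j hj p hp q hq h1 h2
        simp only [Finset.mem_insert, Finset.mem_singleton, not_or] at hj hp hq
        have := hu j hj.1 hj.2
        simp only [SimpleGraph.compl_adj] at this
        rcases hp with rfl | rfl <;> rcases hq with rfl | rfl <;> first | rfl | (exfalso; grind)

/-- `G` has at most one non-edge. -/
def NonEdgesSingle {V : Type*} (G : SimpleGraph V) : Prop :=
  ∃ a b, ∀ x y, Gᶜ.Adj x y → s(x, y) = s(a, b)

/-- The non-edges of `G` lie in a triangle. -/
def NonEdgesTriangle {V : Type*} (G : SimpleGraph V) : Prop :=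
  ∃ a b c, ∀ x y, Gᶜ.Adj x y → s(x, y) = s(a, b) ∨ s(x, y) = s(b, c) ∨ s(x, y) = s(a, c)

/-- The non-edges of `G` are among two given ones. -/
def NonEdgesPair {V : Type*} (G : SimpleGraph V) : Prop :=
  ∃ a b c d, ∀ x y, Gᶜ.Adj x y → s(x, y) = s(a, b) ∨ s(x, y) = s(c, d)

theorem nonEdgesSingle_iff_topCount (hcard : 2 ≤ Fintype.card V) :
    Fintype.card V ≤ topCount G 0 + 2 ↔ NonEdgesSingle G := by
  constructor
  · intro h
    simp only [topCount] at h
    have : Nonempty V := Fintype.card_pos_iff.1 (by omega)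
    by_cases hE : ∃ a b, Gᶜ.Adj a b
    · obtain ⟨a, b, hab⟩ := hE
      refine ⟨a, b, fun x y hxy => ?_⟩
      have k2 : ∀ a b c d, Gᶜ.Adj a b → Gᶜ.Adj c d → a ≠ c → a ≠ d → b ≠ c → b ≠ d → False := by
        intro a b c d h1 h2 h3 h4 h5 h6
        have := lapCount_of_two_disjoint_edges 0 zero_le_one hcard h1 h2 h3 h4 h5 h6
        omega
      have k3 : ∀ a b c, Gᶜ.Adj a b → Gᶜ.Adj b c → a ≠ c → False := by
        intro a b c h1 h2 h3
        have := lapCount_zero_of_path_three hcard h1 h2 h3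
        omega
      have key := k2 a b x y hab hxy
      have hyx := hxy.symm
      have hba := hab.symm
      have q1 := k3 a b
      have q2 := k3 b a
      simp only [Sym2.eq_iff]
      grind +splitImp
    · push Not at hE
      exact ⟨Classical.arbitrary V, Classical.arbitrary V, fun x y h => absurd h (hE x y)⟩
  · rintro ⟨a, b, hv⟩
    refine le_lapCount_add G (k := 1) ![coordDiff a b] 0 fun x _ hx => ?_
    have hxab : x a = x b := by simpa [coordDiff, sub_eq_zero] using hx 0
    rw [zero_mul, complForm_eq_zero]
    intro i j hij
    by_cases hn : G.Adj i j
    · exact Or.inl hn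
    · have := hv i j ((G.compl_adj i j).2 ⟨hij, hn⟩)
      rw [Sym2.eq_iff] at this
      rcases this with ⟨rfl, rfl⟩ | ⟨rfl, rfl⟩ <;> simp [hxab]

/-- Two equalities of coordinates make `x` constant along all non-edges; the named vertices need not
be distinct. -/
theorem topCount_zero_of_nonEdges (h : NonEdgesTriangle G ∨ NonEdgesPair G) :
    Fintype.card V ≤ topCount G 0 + 3 := by
  rcases h with ⟨a, b, c, hv⟩ | ⟨a, b, c, d, hv⟩
  · refine le_lapCount_add G (k := 2)
      ![coordDiff a b, coordDiff b c] 0 fun x _ hx => ?_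
    have hxab : x a = x b := by simpa [coordDiff, sub_eq_zero] using hx 0
    have hxbc : x b = x c := by simpa [coordDiff, sub_eq_zero] using hx 1
    rw [zero_mul, complForm_eq_zero]
    intro i j hij
    by_cases hn : G.Adj i j
    · exact Or.inl hn
    · have := hv i j ((G.compl_adj i j).2 ⟨hij, hn⟩)
      simp only [Sym2.eq_iff] at this
      rcases this with (⟨rfl, rfl⟩ | ⟨rfl, rfl⟩) | (⟨rfl, rfl⟩ | ⟨rfl, rfl⟩) |
        (⟨rfl, rfl⟩ | ⟨rfl, rfl⟩) <;> simp [hxab, hxbc]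
  · refine le_lapCount_add G (k := 2)
      ![coordDiff a b, coordDiff c d] 0 fun x _ hx => ?_
    have hxab : x a = x b := by simpa [coordDiff, sub_eq_zero] using hx 0
    have hxcd : x c = x d := by simpa [coordDiff, sub_eq_zero] using hx 1
    rw [zero_mul, complForm_eq_zero]
    intro i j hij
    by_cases hn : G.Adj i j
    · exact Or.inl hn
    · have := hv i j ((G.compl_adj i j).2 ⟨hij, hn⟩)
      simp only [Sym2.eq_iff] at this
      rcases this with (⟨rfl, rfl⟩ | ⟨rfl, rfl⟩) | (⟨rfl, rfl⟩ | ⟨rfl, rfl⟩) <;>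
        simp [hxab, hxcd]

/-- Unlike `NonEdgesTriangle` and `NonEdgesPair`, the first two alternatives record two non-edges
that are present, so the isomorphism type can be read off. -/
theorem nonEdges_of_topCount_zero (hcard : 2 ≤ Fintype.card V)
    (h : Fintype.card V ≤ topCount G 0 + 3) :
    (∃ a b c, Gᶜ.Adj a b ∧ Gᶜ.Adj b c ∧ a ≠ c ∧ ∀ x y, Gᶜ.Adj x y →
      s(x, y) = s(a, b) ∨ s(x, y) = s(b, c) ∨ s(x, y) = s(a, c)) ∨
    (∃ a b c d, Gᶜ.Adj a b ∧ Gᶜ.Adj c d ∧ a ≠ c ∧ a ≠ d ∧ b ≠ c ∧ b ≠ d ∧ ∀ x y, Gᶜ.Adj x y →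
      s(x, y) = s(a, b) ∨ s(x, y) = s(c, d)) ∨ NonEdgesSingle G := by
  simp only [topCount] at h
  have : Nonempty V := Fintype.card_pos_iff.1 (by omega)
  refine classification_of_no_forest ?_ ?_ ?_ ?_
  · intro a b c d e f h1 h2 h3 g1 g2 g3 g4 g5 g6 g7 g8 g9 g10 g11 g12
    have := lapCount_of_three_disjoint_edges 0 zero_le_one hcard h1 h2 h3 g1 g2 g3 g4 g5 g6 g7 g8
      g9 g10 g11 g12
    omega
  · intro a b c d h1 h2 h3 g1 g2 g3
    have := lapCount_zero_of_path_four hcard h1 h2 h3 g1 g2 g3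
    omega
  · intro a b c d h1 h2 h3 g1 g2 g3
    have := lapCount_zero_of_claw hcard h1 h2 h3 g1 g2 g3
    omega
  · intro a b c d e h1 h2 h3 g1 g2 g3 g4 g5 g6 g7
    have := lapCount_zero_of_path_three_of_disjoint_edge hcard h1 h2 h3 g1 g2 g3 g4 g5 g6 g7
    omega

end Counts

/-! ### Isomorphisms through the complement. -/

section Transport

variable {V W : Type*} {G : SimpleGraph V} {H : SimpleGraph W}

theorem compl_adj_iso (φ : G ≃g H) {x y : V} : Hᶜ.Adj (φ.toEquiv x) (φ.toEquiv y) ↔ Gᶜ.Adj x y := by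
  have h : H.Adj (φ.toEquiv x) (φ.toEquiv y) ↔ G.Adj x y := φ.map_adj_iff
  rw [SimpleGraph.compl_adj, SimpleGraph.compl_adj, h, φ.toEquiv.injective.ne_iff]

theorem isom_of_compl (e : V ≃ W) (h : ∀ x y, Gᶜ.Adj x y ↔ Hᶜ.Adj (e x) (e y)) : Isom G H := by
  refine ⟨⟨e, fun {x y} => ?_⟩⟩
  have := h x y
  simp only [SimpleGraph.compl_adj, e.injective.ne_iff] at this
  by_cases hxy : x = y
  · subst hxy; simp
  · tauto

theorem sym2_eq_symm_iff (φ : V ≃ W) {x y : V} {a b : W} :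
    s(φ x, φ y) = s(a, b) ↔ s(x, y) = s(φ.symm a, φ.symm b) := by
  simp only [Sym2.eq_iff, Equiv.eq_symm_apply]

theorem NonEdgesStar.of_isom (h : Isom G H) (hH : NonEdgesStar H) : NonEdgesStar G := by
  obtain ⟨φ⟩ := h
  obtain ⟨v, hv⟩ := hH
  refine ⟨φ.toEquiv.symm v, fun x y hxy => ?_⟩
  simpa only [Equiv.eq_symm_apply] using hv _ _ ((compl_adj_iso φ).2 hxy)

theorem NonEdgesStarEdge.of_isom (h : Isom G H) (hH : NonEdgesStarEdge H) :
    NonEdgesStarEdge G := by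
  obtain ⟨φ⟩ := h
  obtain ⟨v, a, b, hv⟩ := hH
  refine ⟨φ.toEquiv.symm v, φ.toEquiv.symm a, φ.toEquiv.symm b, fun x y hxy => ?_⟩
  simpa only [Equiv.eq_symm_apply, ← sym2_eq_symm_iff] using hv _ _ ((compl_adj_iso φ).2 hxy)

theorem NonEdgesTwoStars.of_isom (h : Isom G H) (hH : NonEdgesTwoStars H) :
    NonEdgesTwoStars G := by
  obtain ⟨φ⟩ := h
  obtain ⟨v, u, hvu, hv, hu⟩ := hH
  refine ⟨φ.toEquiv.symm v, φ.toEquiv.symm u, by simpa using hvu, fun x y hxy => ?_,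
    fun x xv xu h1 h2 => ?_⟩
  · simpa only [Equiv.eq_symm_apply] using hv _ _ ((compl_adj_iso φ).2 hxy)
  · rw [Ne, Equiv.eq_symm_apply] at xv xu
    rw [← compl_adj_iso φ] at h1 h2
    rw [Equiv.apply_symm_apply] at h1 h2
    exact hu _ xv xu h1 h2

theorem NonEdgesSingle.of_isom (h : Isom G H) (hH : NonEdgesSingle H) : NonEdgesSingle G := by
  obtain ⟨φ⟩ := h
  obtain ⟨a, b, hv⟩ := hH
  refine ⟨φ.toEquiv.symm a, φ.toEquiv.symm b, fun x y hxy => ?_⟩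
  simpa only [← sym2_eq_symm_iff] using hv _ _ ((compl_adj_iso φ).2 hxy)

theorem NonEdgesTriangle.of_isom (h : Isom G H) (hH : NonEdgesTriangle H) :
    NonEdgesTriangle G := by
  obtain ⟨φ⟩ := h
  obtain ⟨a, b, c, hv⟩ := hH
  refine ⟨φ.toEquiv.symm a, φ.toEquiv.symm b, φ.toEquiv.symm c, fun x y hxy => ?_⟩
  simpa only [← sym2_eq_symm_iff] using hv _ _ ((compl_adj_iso φ).2 hxy)

theorem NonEdgesPair.of_isom (h : Isom G H) (hH : NonEdgesPair H) : NonEdgesPair G := by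
  obtain ⟨φ⟩ := h
  obtain ⟨a, b, c, d, hv⟩ := hH
  refine ⟨φ.toEquiv.symm a, φ.toEquiv.symm b, φ.toEquiv.symm c, φ.toEquiv.symm d,
    fun x y hxy => ?_⟩
  simpa only [← sym2_eq_symm_iff] using hv _ _ ((compl_adj_iso φ).2 hxy)

/-- An equivalence extending a given partial matching of points. -/
theorem exists_equiv_extending [Fintype V] [Fintype W] (hcard : Fintype.card V = Fintype.card W)
    {k : ℕ} (f : Fin k → V) (hf : Function.Injective f) (fW : Fin k → W)
    (hfW : Function.Injective fW) : ∃ e : V ≃ W, ∀ i, e (f i) = fW i := by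
  classical
  let e₀ : V ≃ W := Fintype.equivOfCardEq hcard
  let g : Fin k → V := e₀.symm ∘ fW
  have hg : Function.Injective g := e₀.symm.injective.comp hfW
  let σ : {x // x ∈ Set.range f} ≃ {x // x ∈ Set.range g} :=
    (Equiv.ofInjective f hf).symm.trans (Equiv.ofInjective g hg)
  -- `Equiv.extendSubtype` extends a bijection between subsets of one type, so the targets were
  -- first pulled back to `V` along `e₀`.
  refine ⟨σ.extendSubtype.trans e₀, fun i => ?_⟩
  have h1 : σ ⟨f i, i, rfl⟩ = g i := by
    have : (Equiv.ofInjective f hf).symm ⟨f i, i, rfl⟩ = i :=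
      Equiv.ofInjective_symm_apply hf i
    simp [σ, this]
  rw [Equiv.trans_apply, Equiv.extendSubtype_apply_of_mem σ (f i) ⟨i, rfl⟩, h1]
  simp [g]

/-- All vertices outside the labelled ones are adjacent to everything else, so any bijection that
matches the labels is an isomorphism. -/
theorem isom_of_nonEdges [Fintype V] [Fintype W] (hcard : Fintype.card V = Fintype.card W)
    {k : ℕ} (f : Fin k → V) (hf : Function.Injective f) (fW : Fin k → W)
    (hfW : Function.Injective fW) (E : Set (Sym2 (Fin k)))
    (hG : ∀ x y, Gᶜ.Adj x y ↔ s(x, y) ∈ Sym2.map f '' E)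
    (hH : ∀ x y, Hᶜ.Adj x y ↔ s(x, y) ∈ Sym2.map fW '' E) : Isom G H := by
  obtain ⟨e, he⟩ := exists_equiv_extending hcard f hf fW hfW
  refine isom_of_compl e fun x y => ?_
  have h1 : fW = e ∘ f := funext fun i => (he i).symm
  have h2 : s(e x, e y) = Sym2.map e s(x, y) := rfl
  rw [hG, hH, h1, h2, Sym2.map_comp, Set.image_comp,
    (Sym2.map.injective e.injective).mem_set_image]

end Transport

/-! ### Non-edges of the graphs named in the theorem. -/

section Models

theorem compl_deleteEdges_adj {n : ℕ} {E : Set (Sym2 (Fin n))} {x y : Fin n} :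
    ((K n).deleteEdges E)ᶜ.Adj x y ↔ x ≠ y ∧ s(x, y) ∈ E := by
  simp only [SimpleGraph.compl_adj, SimpleGraph.deleteEdges_adj, SimpleGraph.top_adj]
  tauto

theorem mem_starEdges {V : Type*} {v x y : V} {S : Finset V} :
    s(x, y) ∈ starEdges v S ↔ (x = v ∧ y ∈ S) ∨ (y = v ∧ x ∈ S) := by
  simp only [starEdges, Set.mem_ofPred_eq, Sym2.eq_iff]
  constructor
  · rintro ⟨w, hw, ⟨rfl, rfl⟩ | ⟨rfl, rfl⟩⟩ <;> simp [hw]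
  · rintro (⟨rfl, h⟩ | ⟨rfl, h⟩)
    · exact ⟨y, h, by simp⟩
    · exact ⟨x, h, by simp⟩

variable {V : Type*} {G : SimpleGraph V} {n : ℕ}

theorem IsCompleteMinusStar.nonEdgesStar (h : IsCompleteMinusStar n G) : NonEdgesStar G := by
  obtain ⟨v, S, -, -, -, hiso⟩ := h
  refine NonEdgesStar.of_isom hiso ⟨v, fun x y hxy => ?_⟩
  rw [compl_deleteEdges_adj, mem_starEdges] at hxy
  tauto

theorem FamilyA.nonEdgesStarEdge (h : FamilyA n G) : NonEdgesStarEdge G := by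
  obtain ⟨v, a, b, S, -, -, -, -, -, -, hiso⟩ := h
  rw [SimpleGraph.deleteEdges_deleteEdges] at hiso
  refine NonEdgesStarEdge.of_isom hiso ⟨v, a, b, fun x y hxy => ?_⟩
  rw [compl_deleteEdges_adj, Set.mem_union, mem_starEdges, Set.mem_singleton_iff] at hxy
  tauto

theorem FamilyB.nonEdgesTwoStars (h : FamilyB n G) : NonEdgesTwoStars G := by
  obtain ⟨v, u, S, T, hvu, hvS, hvT, huS, huT, hST, -, -, -, -, hiso⟩ := h
  rw [SimpleGraph.deleteEdges_deleteEdges] at hiso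
  refine NonEdgesTwoStars.of_isom hiso ⟨v, u, hvu, fun x y hxy => ?_, fun x xv xu h1 h2 => ?_⟩
  · rw [compl_deleteEdges_adj, Set.mem_union, mem_starEdges, mem_starEdges] at hxy
    tauto
  · rw [compl_deleteEdges_adj, Set.mem_union, mem_starEdges, mem_starEdges] at h1 h2
    have := fun h : x ∈ S => Finset.disjoint_left.1 hST h
    tauto

theorem FamilyC.nonEdgesTwoStars (h : FamilyC n G) : NonEdgesTwoStars G := by
  obtain ⟨v, u, S, T, hvS, hvT, huS, hST, -, -, -, -, hiso⟩ := h
  have hvu : v ≠ u := by rintro rfl; exact hvS huS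
  rw [SimpleGraph.deleteEdges_deleteEdges] at hiso
  refine NonEdgesTwoStars.of_isom hiso ⟨v, u, hvu, fun x y hxy => ?_, fun x xv xu h1 h2 => ?_⟩
  · rw [compl_deleteEdges_adj, Set.mem_union, mem_starEdges, mem_starEdges] at hxy
    tauto
  · rw [compl_deleteEdges_adj, Set.mem_union, mem_starEdges, mem_starEdges] at h1 h2
    have := fun h : x ∈ S => Finset.disjoint_left.1 hST h
    have := hvu.symm
    tauto

theorem graphH_compl_adj {x y : Fin (n - 1)} {p q : Option (Fin (n - 1))}
    (h : (graphH n x y)ᶜ.Adj p q) :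
    (p = none ∧ q ≠ some x) ∨ (q = none ∧ p ≠ some x) ∨ s(p, q) = s(some x, some y) := by
  rw [SimpleGraph.compl_adj, graphH, SimpleGraph.sup_adj, SimpleGraph.map_adj,
    SimpleGraph.edge_adj] at h
  obtain ⟨hne, h⟩ := h
  rw [not_or] at h
  obtain ⟨h1, h2⟩ := h
  rcases p with _ | p <;> rcases q with _ | q
  · exact absurd rfl hne
  · left
    refine ⟨rfl, fun hq => h2 ?_⟩
    simp [hq]
  · right; left
    refine ⟨rfl, fun hq => h2 ?_⟩
    simp [hq]
  · right; right
    by_contra hs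
    refine h1 ⟨p, q, ?_, rfl, rfl⟩
    rw [SimpleGraph.deleteEdges_adj, SimpleGraph.top_adj, Set.mem_singleton_iff]
    refine ⟨fun h => hne (by rw [h]), fun h => hs ?_⟩
    have := congrArg (Sym2.map some) h
    simpa using this

theorem IsH.nonEdgesTwoStars (h : IsH n G) : NonEdgesTwoStars G := by
  obtain ⟨x, y, hxy, hiso⟩ := h
  -- The new vertex misses everything but `x`, and the only other non-edge is `xy`; hence the
  -- centres `none` and `y`.
  refine NonEdgesTwoStars.of_isom hiso ⟨none, some y, by simp, fun p q hpq => ?_,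
    fun p hp hp' h1 h2 => ?_⟩
  · rcases graphH_compl_adj hpq with h | h | h
    · exact Or.inl h.1
    · exact Or.inr (Or.inr (Or.inl h.1))
    · rw [Sym2.eq_iff] at h
      tauto
  · have k1 := graphH_compl_adj h1
    have k2 := graphH_compl_adj h2
    have hxy' : some y ≠ some x := by simpa using hxy.symm
    simp only [Sym2.eq_iff] at k1 k2
    simp_all

theorem graphHa_adj_inl_inl {a : ℕ} {i j : Fin 4} :
    (graphHa n a).Adj (Sum.inl i) (Sum.inl j) ↔ (SimpleGraph.pathGraph 4).Adj i j := by
  simp [graphHa]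

theorem graphHa_adj_inr_inr {a : ℕ} {i j : Fin (n - 4)} :
    (graphHa n a).Adj (Sum.inr i) (Sum.inr j) ↔ i ≠ j := by
  simp [graphHa]

theorem graphHa_adj_inl_inr {a : ℕ} {i : Fin 4} {j : Fin (n - 4)} :
    (graphHa n a).Adj (Sum.inl i) (Sum.inr j) ↔
      (i = 1 ∨ i = 2 ∨ (i = 0 ∧ (j : ℕ) < a) ∨ (i = 3 ∧ a ≤ (j : ℕ))) := by
  simp [graphHa]

theorem IsHa.nonEdgesTwoStars (h : IsHa n G) : NonEdgesTwoStars G := by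
  obtain ⟨a, -, -, hiso⟩ := h
  -- The ends of the path are the centres: each vertex of `K_{n-4}` is joined to exactly one of
  -- them.
  refine NonEdgesTwoStars.of_isom hiso ⟨Sum.inl 0, Sum.inl 3, by simp, ?_, ?_⟩
  · intro p q hpq
    rw [SimpleGraph.compl_adj] at hpq
    obtain ⟨hne, hpq⟩ := hpq
    rcases p with i | i <;> rcases q with j | j
    · rw [graphHa_adj_inl_inl, SimpleGraph.pathGraph_adj] at hpq
      simp only [Sum.inl.injEq, ne_eq, Fin.ext_iff] at hne ⊢
      simp
      omega
    · rw [graphHa_adj_inl_inr] at hpq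
      simp only [Sum.inl.injEq, Fin.ext_iff] at hpq ⊢
      simp at hpq ⊢
      omega
    · rw [SimpleGraph.adj_comm, graphHa_adj_inl_inr] at hpq
      simp only [Sum.inl.injEq, Fin.ext_iff] at hpq ⊢
      simp at hpq ⊢
      omega
    · rw [graphHa_adj_inr_inr] at hpq
      exact absurd (congrArg Sum.inr (not_not.1 hpq)) hne
  · intro p hp hp' h1 h2
    rw [SimpleGraph.compl_adj] at h1 h2
    rcases p with i | i
    · rw [graphHa_adj_inl_inl, SimpleGraph.pathGraph_adj] at h1 h2
      simp only [Sum.inl.injEq, ne_eq, Fin.ext_iff] at h1 h2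
      simp at h1 h2
      omega
    · rw [graphHa_adj_inl_inr] at h1 h2
      simp at h1 h2
      omega

theorem compl_join_three {m : ℕ} (x y : Fin m ⊕ ((Fin 1 ⊕ Fin 1) ⊕ Fin 1)) :
    (join (K m) (K 1 ⊕g K 1 ⊕g K 1))ᶜ.Adj x y ↔
      s(x, y) ∈ Sym2.map ![Sum.inr (Sum.inl (Sum.inl 0)), Sum.inr (Sum.inl (Sum.inr 0)),
        Sum.inr (Sum.inr 0)] '' {s(0, 1), s(1, 2), s(0, 2)} := by
  rcases x with x | (x | x) | x <;> rcases y with y | (y | y) | y <;>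
    simp [join, Set.image_insert_eq, Fin.fin_one_eq_zero]

/-- The complement of `K₁ ∪ K₂` is a path on three vertices centred at the `K₁`, which therefore
takes the middle label. -/
theorem compl_join_one_two {m : ℕ} (x y : Fin m ⊕ (Fin 1 ⊕ Fin 2)) :
    (join (K m) (K 1 ⊕g K 2))ᶜ.Adj x y ↔
      s(x, y) ∈ Sym2.map ![Sum.inr (Sum.inr 0), Sum.inr (Sum.inl 0), Sum.inr (Sum.inr 1)] ''
        {s(0, 1), s(1, 2)} := by
  rcases x with x | x | x <;> rcases y with y | y | y <;>
    simp [join, Set.image_insert_eq, Fin.fin_one_eq_zero] <;> first | tauto | omega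

theorem compl_join_two_two {m : ℕ} (x y : Fin m ⊕ (Fin 2 ⊕ Fin 2)) :
    (join (K m) (K 2 ⊕g K 2)ᶜ)ᶜ.Adj x y ↔
      s(x, y) ∈ Sym2.map ![Sum.inr (Sum.inl 0), Sum.inr (Sum.inl 1), Sum.inr (Sum.inr 0),
        Sum.inr (Sum.inr 1)] '' {s(0, 1), s(2, 3)} := by
  rcases x with x | x | x <;> rcases y with y | y | y <;>
    simp [join, Set.image_insert_eq] <;> first | tauto | omega

end Models

/-! ### From the shape of the non-edges to the listed families. -/

section Families

variable {V : Type*} {G : SimpleGraph V} {n : ℕ}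

theorem isom_deleteEdges_star (e : V ≃ Fin n) (v : V) (S : Finset V)
    (h : ∀ x y, Gᶜ.Adj x y ↔ s(x, y) ∈ starEdges v S) :
    Isom G ((K n).deleteEdges (starEdges (e v) (S.map e.toEmbedding))) := by
  refine isom_of_compl e fun x y => ?_
  have hne : Gᶜ.Adj x y → x ≠ y := fun h => h.ne
  rw [compl_deleteEdges_adj, mem_starEdges]
  rw [h, mem_starEdges] at hne
  rw [h, mem_starEdges]
  simp only [e.injective.ne_iff, e.injective.eq_iff, Finset.mem_map_equiv,
    Equiv.symm_apply_apply]
  tauto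

theorem isom_deleteEdges_two_stars (e : V ≃ Fin n) (v u : V) (S T : Finset V)
    (h : ∀ x y, Gᶜ.Adj x y ↔ s(x, y) ∈ starEdges v S ∨ s(x, y) ∈ starEdges u T) :
    Isom G (((K n).deleteEdges (starEdges (e v) (S.map e.toEmbedding))).deleteEdges
      (starEdges (e u) (T.map e.toEmbedding))) := by
  rw [SimpleGraph.deleteEdges_deleteEdges]
  refine isom_of_compl e fun x y => ?_
  have hne : Gᶜ.Adj x y → x ≠ y := fun h => h.ne
  rw [compl_deleteEdges_adj, Set.mem_union, mem_starEdges, mem_starEdges]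
  rw [h, mem_starEdges, mem_starEdges] at hne
  rw [h, mem_starEdges, mem_starEdges]
  simp only [e.injective.ne_iff, e.injective.eq_iff, Finset.mem_map_equiv,
    Equiv.symm_apply_apply]
  tauto

theorem joins_nonEdges
    (h : Isom G (join (K (n - 3)) (K 1 ⊕g K 1 ⊕g K 1)) ∨
      Isom G (join (K (n - 3)) (K 1 ⊕g K 2)) ∨ Isom G (join (K (n - 4)) (K 2 ⊕g K 2)ᶜ)) :
    NonEdgesTriangle G ∨ NonEdgesPair G := by
  rcases h with h | h | h
  · refine Or.inl (NonEdgesTriangle.of_isom h ⟨Sum.inr (Sum.inl (Sum.inl 0)),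
      Sum.inr (Sum.inl (Sum.inr 0)), Sum.inr (Sum.inr 0), fun x y hxy => ?_⟩)
    rw [compl_join_three, Set.image_insert_eq, Set.image_insert_eq, Set.image_singleton] at hxy
    exact hxy
  · refine Or.inl (NonEdgesTriangle.of_isom h ⟨Sum.inr (Sum.inr 0), Sum.inr (Sum.inl 0),
      Sum.inr (Sum.inr 1), fun x y hxy => ?_⟩)
    rw [compl_join_one_two, Set.image_insert_eq, Set.image_singleton] at hxy
    rw [← or_assoc]
    exact Or.inl hxy
  · refine Or.inr (NonEdgesPair.of_isom h ⟨Sum.inr (Sum.inl 0), Sum.inr (Sum.inl 1),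
      Sum.inr (Sum.inr 0), Sum.inr (Sum.inr 1), fun x y hxy => ?_⟩)
    rw [compl_join_two_two, Set.image_insert_eq, Set.image_singleton] at hxy
    exact hxy

variable [Fintype V]

theorem isom_K_iff (hcard : Fintype.card V = n) : Isom G (K n) ↔ ∀ x y, ¬ Gᶜ.Adj x y := by
  constructor
  · rintro ⟨φ⟩ x y hxy
    rw [← compl_adj_iso φ, compl_top] at hxy
    exact hxy
  · intro h
    refine isom_of_compl (Fintype.equivFinOfCardEq hcard) fun x y => ?_
    rw [compl_top]
    exact ⟨fun hxy => absurd hxy (h x y), fun hxy => hxy.elim⟩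

theorem isCompleteMinusEdge_iff (hcard : Fintype.card V = n) :
    IsCompleteMinusEdge n G ↔ NonEdgesSingle G ∧ ∃ x y, Gᶜ.Adj x y := by
  constructor
  · rintro ⟨e, he, hiso⟩
    induction e using Sym2.ind with | _ a b => ?_
    refine ⟨NonEdgesSingle.of_isom hiso ⟨a, b, fun x y hxy => ?_⟩, ?_⟩
    · rw [compl_deleteEdges_adj] at hxy
      exact hxy.2
    · obtain ⟨φ⟩ := hiso
      refine ⟨φ.toEquiv.symm a, φ.toEquiv.symm b, ?_⟩
      rw [← compl_adj_iso φ, Equiv.apply_symm_apply, Equiv.apply_symm_apply,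
        compl_deleteEdges_adj]
      exact ⟨((K n).mem_edgeSet.1 he).ne, rfl⟩
  · rintro ⟨⟨a, b, h⟩, x, y, hxy⟩
    let e := Fintype.equivFinOfCardEq hcard
    refine ⟨s(e x, e y), by simpa using hxy.ne, isom_of_compl e fun p q => ?_⟩
    rw [compl_deleteEdges_adj, Set.mem_singleton_iff, sym2_eq_symm_iff, Equiv.symm_apply_apply,
      Equiv.symm_apply_apply]
    constructor
    · intro hpq
      exact ⟨by simpa using hpq.ne, (h p q hpq).trans (h x y hxy).symm⟩
    · rintro ⟨-, hs⟩
      rw [Sym2.eq_iff] at hs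
      rcases hs with ⟨rfl, rfl⟩ | ⟨rfl, rfl⟩
      · exact hxy
      · exact hxy.symm

variable [DecidableEq V] [DecidableRel G.Adj]

/-- In a connected graph every vertex misses itself and a neighbour in its set of
non-neighbours. -/
theorem card_compl_neighborFinset_add_two_le (hconn : G.Connected) (hcard : 2 ≤ Fintype.card V)
    (v : V) : (Gᶜ.neighborFinset v).card + 2 ≤ Fintype.card V := by
  have : Nontrivial V := Fintype.one_lt_card_iff_nontrivial.1 (by omega)
  obtain ⟨w, hw⟩ := hconn.preconnected.exists_adj_of_nontrivial v
  have hd : Disjoint (Gᶜ.neighborFinset v) {v, w} := by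
    rw [Finset.disjoint_right]
    intro x hx
    simp only [Finset.mem_insert, Finset.mem_singleton] at hx
    rcases hx with rfl | rfl <;> simp [hw]
  have := Finset.card_le_univ (Gᶜ.neighborFinset v ∪ {v, w})
  rwa [Finset.card_union_of_disjoint hd, Finset.card_pair hw.ne] at this

theorem NonEdgesStar.isCompleteMinusStar (hconn : G.Connected) (hcard : Fintype.card V = n)
    (hn : 2 ≤ n) (h : NonEdgesStar G) (hG : ∃ x y, Gᶜ.Adj x y) : IsCompleteMinusStar n G := by
  obtain ⟨v, hv⟩ := h
  obtain ⟨x, y, hxy⟩ := hG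
  let e := Fintype.equivFinOfCardEq hcard
  have hcd := card_compl_neighborFinset_add_two_le hconn (by omega) v
  have hpos : 0 < (Gᶜ.neighborFinset v).card := by
    rw [Finset.card_pos]
    rcases hv x y hxy with rfl | rfl
    · exact ⟨y, by rwa [SimpleGraph.mem_neighborFinset]⟩
    · exact ⟨x, by rw [SimpleGraph.mem_neighborFinset]; exact hxy.symm⟩
  refine ⟨e v, (Gᶜ.neighborFinset v).map e.toEmbedding, by simp, ?_, ?_,
    isom_deleteEdges_star e v _ fun p q => ?_⟩
  · rw [Finset.card_map]; omega
  · rw [Finset.card_map]; omega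
  · rw [mem_starEdges, SimpleGraph.mem_neighborFinset, SimpleGraph.mem_neighborFinset]
    constructor
    · intro hpq
      rcases hv p q hpq with rfl | rfl
      · exact Or.inl ⟨rfl, hpq⟩
      · exact Or.inr ⟨rfl, hpq.symm⟩
    · rintro (⟨rfl, h⟩ | ⟨rfl, h⟩)
      · exact h
      · exact h.symm

/-- The extra non-edge `ab` avoids `v`, since otherwise there is a single star. If `v` misses both
`a` and `b` this is family (a). If `v` is adjacent to one of them, the other serves as second centre
with that one as its private leaf. -/
theorem NonEdgesStarEdge.familyA_or (hconn : G.Connected) (hcard : Fintype.card V = n)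
    (hn : 2 ≤ n) (h : NonEdgesStarEdge G) (hG : ¬ NonEdgesStar G) :
    FamilyA n G ∨ NonEdgesTwoStars G := by
  obtain ⟨v, a, b, hv⟩ := h
  have hab : Gᶜ.Adj a b ∧ a ≠ v ∧ b ≠ v := by
    by_contra hcon
    refine hG ⟨v, fun x y hxy => ?_⟩
    rcases hv x y hxy with h | h | h
    · exact Or.inl h
    · exact Or.inr h
    · rw [Sym2.eq_iff] at h
      rcases h with ⟨rfl, rfl⟩ | ⟨rfl, rfl⟩
      · have := hxy
        tauto
      · have := hxy.symm
        tauto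
  obtain ⟨hab, hav, hbv⟩ := hab
  by_cases ha : Gᶜ.Adj v a
  swap
  · right
    refine ⟨v, b, hbv.symm, fun x y hxy => ?_, fun x xv xb h1 h2 => ?_⟩
    · have := hv x y hxy
      rw [Sym2.eq_iff] at this
      tauto
    · have := hv b x h2
      rw [Sym2.eq_iff] at this
      have : x = a := by have := hab.ne; tauto
      exact ha (this ▸ h1)
  by_cases hb : Gᶜ.Adj v b
  swap
  · right
    refine ⟨v, a, hav.symm, fun x y hxy => ?_, fun x xv xb h1 h2 => ?_⟩
    · have := hv x y hxy
      rw [Sym2.eq_iff] at this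
      tauto
    · have := hv a x h2
      rw [Sym2.eq_iff] at this
      have : x = b := by have := hab.ne; tauto
      exact hb (this ▸ h1)
  left
  let e := Fintype.equivFinOfCardEq hcard
  have hcd := card_compl_neighborFinset_add_two_le hconn (by omega) v
  have h2 : 2 ≤ (Gᶜ.neighborFinset v).card := by
    rw [← Finset.card_pair hab.ne]
    refine Finset.card_le_card fun x hx => ?_
    simp only [Finset.mem_insert, Finset.mem_singleton] at hx
    rw [SimpleGraph.mem_neighborFinset]
    rcases hx with rfl | rfl <;> assumption
  refine ⟨e v, e a, e b, (Gᶜ.neighborFinset v).map e.toEmbedding, by simp, ?_, ?_, ?_, ?_, ?_, ?_⟩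
  · rw [Finset.mem_map_equiv, Equiv.symm_apply_apply, SimpleGraph.mem_neighborFinset]; exact ha
  · rw [Finset.mem_map_equiv, Equiv.symm_apply_apply, SimpleGraph.mem_neighborFinset]; exact hb
  · simpa using hab.ne
  · rw [Finset.card_map]; omega
  · rw [Finset.card_map]; omega
  · rw [SimpleGraph.deleteEdges_deleteEdges]
    refine isom_of_compl e fun x y => ?_
    rw [compl_deleteEdges_adj, Set.mem_union, mem_starEdges, Set.mem_singleton_iff,
      sym2_eq_symm_iff]
    simp only [e.injective.ne_iff, e.injective.eq_iff, Finset.mem_map_equiv,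
      Equiv.symm_apply_apply, SimpleGraph.mem_neighborFinset]
    constructor
    · intro hxy
      refine ⟨hxy.ne, ?_⟩
      rcases hv x y hxy with rfl | rfl | h
      · exact Or.inl (Or.inl ⟨rfl, hxy⟩)
      · exact Or.inl (Or.inr ⟨rfl, hxy.symm⟩)
      · exact Or.inr h
    · rintro ⟨-, (⟨rfl, h⟩ | ⟨rfl, h⟩) | h⟩
      · exact h
      · exact h.symm
      · rw [Sym2.eq_iff] at h
        rcases h with ⟨rfl, rfl⟩ | ⟨rfl, rfl⟩
        · exact hab
        · exact hab.symm

/-- Family (b) or (c) arises according to whether the centres are adjacent in `G`. -/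
theorem NonEdgesTwoStars.familyB_or_familyC (hconn : G.Connected) (hcard : Fintype.card V = n)
    (hn : 2 ≤ n) (h : NonEdgesTwoStars G) (hG : ¬ NonEdgesStar G) :
    FamilyB n G ∨ FamilyC n G := by
  -- Taking `v` to be the centre with more non-neighbours gives `t ≤ s` in (b) and `t ≤ s - 1` in
  -- (c).
  obtain ⟨v, u, hvu, hv, hu, hle⟩ : ∃ v u, v ≠ u ∧
      (∀ x y, Gᶜ.Adj x y → x = v ∨ x = u ∨ y = v ∨ y = u) ∧
      (∀ x, x ≠ v → x ≠ u → Gᶜ.Adj v x → ¬ Gᶜ.Adj u x) ∧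
      (Gᶜ.neighborFinset u).card ≤ (Gᶜ.neighborFinset v).card := by
    obtain ⟨v, u, hvu, hv, hu⟩ := h
    rcases le_total (Gᶜ.neighborFinset u).card (Gᶜ.neighborFinset v).card with h | h
    · exact ⟨v, u, hvu, hv, hu, h⟩
    · refine ⟨u, v, hvu.symm, fun x y hxy => ?_, fun x h1 h2 h3 h4 => hu x h2 h1 h4 h3, h⟩
      have := hv x y hxy
      tauto
  let e := Fintype.equivFinOfCardEq hcard
  have hcd := card_compl_neighborFinset_add_two_le hconn (by omega) v
  have hu' : ∃ z, Gᶜ.Adj u z ∧ z ≠ v := by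
    by_contra! hcon
    refine hG ⟨v, fun x y hxy => ?_⟩
    rcases hv x y hxy with rfl | rfl | rfl | rfl
    · exact Or.inl rfl
    · exact Or.inr (hcon y hxy)
    · exact Or.inr rfl
    · exact Or.inl (hcon x hxy.symm)
  obtain ⟨z, hz, hzv⟩ := hu'
  set S := Gᶜ.neighborFinset v with hS
  -- A possible non-edge `vu` is attributed to the star at `v` only, which makes `S` and `T`
  -- disjoint.
  set T := (Gᶜ.neighborFinset u).erase v with hT
  have mS : ∀ x, x ∈ S ↔ Gᶜ.Adj v x := fun x => by rw [hS, SimpleGraph.mem_neighborFinset]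
  have mT : ∀ x, x ∈ T ↔ x ≠ v ∧ Gᶜ.Adj u x := fun x => by
    rw [hT, Finset.mem_erase, SimpleGraph.mem_neighborFinset]
  have hST : Disjoint S T := by
    rw [Finset.disjoint_left]
    intro x hx hx'
    rw [mS] at hx
    rw [mT] at hx'
    exact hu x hx'.1 hx'.2.ne' hx hx'.2
  have hT1 : 1 ≤ T.card := Finset.card_pos.2 ⟨z, (mT z).2 ⟨hzv, hz⟩⟩
  have hvS : v ∉ S := by rw [mS]; exact Gᶜ.irrefl
  have hvT : v ∉ T := by rw [mT]; exact fun h => h.1 rfl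
  have huT : u ∉ T := by rw [mT]; exact fun h => Gᶜ.irrefl h.2
  have hedges : ∀ x y, Gᶜ.Adj x y ↔ s(x, y) ∈ starEdges v S ∨ s(x, y) ∈ starEdges u T := by
    intro x y
    rw [mem_starEdges, mem_starEdges, mS, mS, mT, mT]
    constructor
    · intro hxy
      have hyx := hxy.symm
      by_cases hx : x = v
      · exact Or.inl (Or.inl ⟨hx, hx ▸ hxy⟩)
      by_cases hy : y = v
      · exact Or.inl (Or.inr ⟨hy, hy ▸ hyx⟩)
      rcases hv x y hxy with h | h | h | h
      · exact absurd h hx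
      · exact Or.inr (Or.inl ⟨h, hy, h ▸ hxy⟩)
      · exact absurd h hy
      · exact Or.inr (Or.inr ⟨h, hx, h ▸ hyx⟩)
    · rintro ((⟨rfl, h⟩ | ⟨rfl, h⟩) | (⟨rfl, h⟩ | ⟨rfl, h⟩))
      · exact h
      · exact h.symm
      · exact h.2
      · exact h.2.symm
  have hiso := isom_deleteEdges_two_stars e v u S T hedges
  have hmem : ∀ (x : V) (A : Finset V), e x ∈ A.map e.toEmbedding ↔ x ∈ A := fun x A => by
    rw [Finset.mem_map_equiv, Equiv.symm_apply_apply]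
  have hdisj : Disjoint (S.map e.toEmbedding) (T.map e.toEmbedding) :=
    (Finset.disjoint_map _).2 hST
  by_cases huS : Gᶜ.Adj v u
  · right
    have hTlt : T.card + 1 = (Gᶜ.neighborFinset u).card :=
      Finset.card_erase_add_one (by rw [SimpleGraph.mem_neighborFinset]; exact huS.symm)
    have htot : S.card + T.card + 1 ≤ n := by
      have h1 : v ∉ S ∪ T := by simp only [Finset.mem_union]; tauto
      have := Finset.card_le_univ (insert v (S ∪ T))
      rw [Finset.card_insert_of_notMem h1, Finset.card_union_of_disjoint hST, hcard] at this
      exact this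
    refine ⟨e v, e u, S.map e.toEmbedding, T.map e.toEmbedding, by rwa [hmem], by rwa [hmem],
      by rwa [hmem, mS], hdisj, ?_, ?_, ?_, ?_, hiso⟩ <;> simp only [Finset.card_map] <;> omega
  · left
    have huS' : u ∉ S := by rwa [mS]
    have hTeq : T.card = (Gᶜ.neighborFinset u).card := by
      rw [hT, Finset.erase_eq_of_notMem]
      rw [SimpleGraph.mem_neighborFinset]
      exact fun h => huS h.symm
    have htot : S.card + T.card + 2 ≤ n := by
      have h1 : v ∉ S ∪ T := by simp only [Finset.mem_union]; tauto
      have h2 : u ∉ insert v (S ∪ T) := by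
        simp only [Finset.mem_insert, Finset.mem_union]
        have := hvu.symm
        tauto
      have := Finset.card_le_univ (insert u (insert v (S ∪ T)))
      rw [Finset.card_insert_of_notMem h2, Finset.card_insert_of_notMem h1,
        Finset.card_union_of_disjoint hST, hcard] at this
      exact this
    refine ⟨e v, e u, S.map e.toEmbedding, T.map e.toEmbedding, by simpa using hvu,
      by rwa [hmem], by rwa [hmem], by rwa [hmem], by rwa [hmem], hdisj, ?_, ?_, ?_, ?_, hiso⟩ <;>
      simp only [Finset.card_map] <;> omega

/-- `H(n)` and `H(n,a)` are themselves two-star graphs, hence already in (b) or (c); the forward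
direction never has to produce them. -/
theorem families_iff (hconn : G.Connected) (hcard : Fintype.card V = n) (hn : 2 ≤ n)
    (hG : ¬ NonEdgesStar G) :
    (NonEdgesStarEdge G ∨ NonEdgesTwoStars G) ↔
      (IsH n G ∨ IsHa n G ∨ FamilyA n G ∨ FamilyB n G ∨ FamilyC n G) := by
  constructor
  · intro h
    have h2 : FamilyA n G ∨ NonEdgesTwoStars G :=
      h.elim (fun h => h.familyA_or hconn hcard hn hG) Or.inr
    rcases h2 with h | h
    · tauto
    · have := h.familyB_or_familyC hconn hcard hn hG
      tauto
  · rintro (h | h | h | h | h)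
    · exact Or.inr h.nonEdgesTwoStars
    · exact Or.inr h.nonEdgesTwoStars
    · exact Or.inl h.nonEdgesStarEdge
    · exact Or.inr h.nonEdgesTwoStars
    · exact Or.inr h.nonEdgesTwoStars

theorem joins_iff (hcard : Fintype.card V = n) (hn : 4 ≤ n) (hG : ¬ NonEdgesSingle G) :
    Fintype.card V ≤ topCount G 0 + 3 ↔
      (Isom G (join (K (n - 3)) (K 1 ⊕g K 1 ⊕g K 1)) ∨
      Isom G (join (K (n - 3)) (K 1 ⊕g K 2)) ∨ Isom G (join (K (n - 4)) (K 2 ⊕g K 2)ᶜ)) := by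
  refine ⟨fun h => ?_, fun h => topCount_zero_of_nonEdges (joins_nonEdges h)⟩
  rcases nonEdges_of_topCount_zero (by omega) h with
    ⟨a, b, c, hab, hbc, hac, h⟩ | ⟨a, b, c, d, hab, hcd, hac, had, hbc, hbd, h⟩ | h
  · have hinj : Function.Injective ![a, b, c] := by
      rw [← List.nodup_ofFn]
      simp [List.ofFn_succ, hab.ne, hbc.ne, hac]
    by_cases hadj : Gᶜ.Adj a c
    · left
      refine isom_of_nonEdges ?_ _ hinj _ ?_ _ (fun x y => ?_) compl_join_three
      · simp [hcard]; omega
      · rw [← List.nodup_ofFn]; simp [List.ofFn_succ]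
      · simp only [Set.image_insert_eq, Set.image_singleton, Sym2.map_mk, Set.mem_insert_iff,
          Set.mem_singleton_iff]
        refine ⟨h x y, fun hxy => ?_⟩
        simp only [Matrix.cons_val, Sym2.eq_iff] at hxy
        rcases hxy with (⟨rfl, rfl⟩ | ⟨rfl, rfl⟩) | (⟨rfl, rfl⟩ | ⟨rfl, rfl⟩) |
          (⟨rfl, rfl⟩ | ⟨rfl, rfl⟩)
        exacts [hab, hab.symm, hbc, hbc.symm, hadj, hadj.symm]
    · right; left
      refine isom_of_nonEdges ?_ _ hinj _ ?_ _ (fun x y => ?_) compl_join_one_two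
      · simp [hcard]; omega
      · rw [← List.nodup_ofFn]; simp [List.ofFn_succ]
      · simp only [Set.image_insert_eq, Set.image_singleton, Sym2.map_mk, Set.mem_insert_iff,
          Set.mem_singleton_iff]
        constructor
        · intro hxy
          rcases h x y hxy with h | h | h
          · exact Or.inl h
          · exact Or.inr h
          · rw [Sym2.eq_iff] at h
            rcases h with ⟨rfl, rfl⟩ | ⟨rfl, rfl⟩
            · exact absurd hxy hadj
            · exact absurd hxy.symm hadj
        · intro hxy
          simp only [Matrix.cons_val, Sym2.eq_iff] at hxy
          rcases hxy with (⟨rfl, rfl⟩ | ⟨rfl, rfl⟩) | (⟨rfl, rfl⟩ | ⟨rfl, rfl⟩)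
          exacts [hab, hab.symm, hbc, hbc.symm]
  · right; right
    have hinj : Function.Injective ![a, b, c, d] := by
      rw [← List.nodup_ofFn]
      simp [List.ofFn_succ, hab.ne, hcd.ne, hac, had, hbc, hbd]
    refine isom_of_nonEdges ?_ _ hinj _ ?_ _ (fun x y => ?_) compl_join_two_two
    · simp [hcard]; omega
    · rw [← List.nodup_ofFn]; simp [List.ofFn_succ]
    · simp only [Set.image_insert_eq, Set.image_singleton, Sym2.map_mk, Set.mem_insert_iff,
        Set.mem_singleton_iff]
      refine ⟨h x y, fun hxy => ?_⟩
      simp only [Matrix.cons_val, Sym2.eq_iff] at hxy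
      rcases hxy with (⟨rfl, rfl⟩ | ⟨rfl, rfl⟩) | (⟨rfl, rfl⟩ | ⟨rfl, rfl⟩)
      exacts [hab, hab.symm, hcd, hcd.symm]
  · exact absurd h hG

end Families

end GirthThree

/-! ### The theorem. -/

open GirthThree in
theorem theorem1p3 {V : Type*} [Fintype V] [DecidableEq V] (G : SimpleGraph V)
    [DecidableRel G.Adj] (n : ℕ) (hn : 5 ≤ n) (hcard : Fintype.card V = n)
    (hconn : G.Connected) (hgirth : G.girth = 3) :
    ((lapCount G {(n : ℝ)} = n - 1 ↔ Isom G (K n)) ∧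
      (lapCount G {(n : ℝ)} = n - 2 ↔ IsCompleteMinusEdge n G) ∧
      (¬ Isom G (K n) → ¬ IsCompleteMinusEdge n G →
        lapCount G {(n : ℝ)} ≤ n - 3 ∧
        (lapCount G {(n : ℝ)} = n - 3 ↔
          Isom G (join (K (n - 3)) (K 1 ⊕g K 1 ⊕g K 1)) ∨
          Isom G (join (K (n - 3)) (K 1 ⊕g K 2)) ∨
          Isom G (join (K (n - 4)) (K 2 ⊕g K 2)ᶜ)))) ∧
    ((lapCount G (Set.Icc ((n : ℝ) - 1) n) = n - 1 ↔ Isom G (K n)) ∧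
      (lapCount G (Set.Icc ((n : ℝ) - 1) n) = n - 2 ↔ IsCompleteMinusStar n G) ∧
      (¬ Isom G (K n) → ¬ IsCompleteMinusStar n G →
        lapCount G (Set.Icc ((n : ℝ) - 1) n) ≤ n - 3 ∧
        (lapCount G (Set.Icc ((n : ℝ) - 1) n) = n - 3 ↔
          IsH n G ∨ IsHa n G ∨ FamilyA n G ∨ FamilyB n G ∨ FamilyC n G))) := by
  have h2 : 2 ≤ Fintype.card V := by omega
  have e0 : lapCount G {(n : ℝ)} = topCount G 0 := by
    rw [topCount, hcard, sub_zero, Set.Icc_self]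
  have e1 : lapCount G (Set.Icc ((n : ℝ) - 1) n) = topCount G 1 := by rw [topCount, hcard]
  rw [e0, e1]
  have u0 : topCount G 0 + 1 ≤ Fintype.card V := lapCount_add_one_le 0 zero_le_one h2
  have u1 : topCount G 1 + 1 ≤ Fintype.card V := lapCount_add_one_le 1 le_rfl h2
  have c0 := complete_iff_topCount (G := G) 0 le_rfl zero_le_one h2
  have c1 := complete_iff_topCount (G := G) 1 zero_le_one le_rfl h2
  have hK := isom_K_iff (G := G) hcard
  rw [← hK] at c0 c1
  have hne : ¬ Isom G (K n) ↔ ∃ x y, Gᶜ.Adj x y := by rw [hK]; push Not; rfl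
  have s0 := nonEdgesSingle_iff_topCount (G := G) h2
  have hE := isCompleteMinusEdge_iff (G := G) hcard
  -- Every graph class becomes an inequality between `n` and `topCount`, so the exact values reduce
  -- to arithmetic.
  rw [← s0, ← hne, ← c0] at hE
  have s1 := nonEdgesStar_iff_topCount (G := G) h2
  have hS : IsCompleteMinusStar n G ↔
      Fintype.card V ≤ topCount G 1 + 2 ∧ ¬ Fintype.card V ≤ topCount G 1 + 1 := by
    rw [s1, c1, hne]
    refine ⟨fun h => ⟨h.nonEdgesStar, ?_⟩, fun h =>
      h.1.isCompleteMinusStar hconn hcard (by omega) h.2⟩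
    obtain ⟨v, S, hv, hS, -, ⟨φ⟩⟩ := h
    obtain ⟨w, hw⟩ := Finset.card_pos.1 hS
    refine ⟨φ.toEquiv.symm v, φ.toEquiv.symm w, ?_⟩
    rw [← compl_adj_iso φ, Equiv.apply_symm_apply, Equiv.apply_symm_apply, compl_deleteEdges_adj,
      mem_starEdges]
    exact ⟨fun h => hv (h ▸ hw), Or.inl ⟨rfl, hw⟩⟩
  refine ⟨⟨?_, ?_, fun h h' => ?_⟩, ?_, ?_, fun h h' => ?_⟩
  · rw [← c0]; omega
  · rw [hE]; omega
  · rw [← c0] at h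
    rw [hE] at h'
    have hs : ¬ Fintype.card V ≤ topCount G 0 + 2 := fun k => h' ⟨k, h⟩
    rw [← joins_iff hcard (by omega) (s0.not.1 hs)]
    omega
  · rw [← c1]; omega
  · rw [hS]; omega
  · rw [← c1] at h
    rw [hS] at h'
    have hs : ¬ Fintype.card V ≤ topCount G 1 + 2 := fun k => h' ⟨k, h⟩
    rw [← families_iff hconn hcard (by omega) (s1.not.1 hs), ← nonEdges_iff_topCount h2]
    omega
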